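/- Let $K$ be a field of characteristic different from $2$ and let $k$ be an algebraically closed field containing $K$. A *Ciani subgroup* of a smooth plane quartic $Y/k$ is a subgroup $V\subset \mathrm{Aut}_k(Y)$ with $V\simeq C_2\times C_2$ such that the quotient curve $Y/V$ has genus $0$; if $V$ is such a subgroup, $(Y,V)$ is called a Ciani quartic. The quartic $Y$ is called *special* if it has more than one Ciani subgroup. A *standard model* of $(Y,V)$ is a smooth quartic $$Y_1:\ Ax^4+By^4+Cz^4+ay^2z^2+bx^2z^2+cx^2y^2=0$$ over $k$ that is isomorphic to $Y$, such that $V$ corresponds to the group of all automorphisms $(x:y:z)\mapsto(\pm x:\pm y:\pm z)$. Its Ciani invariants are $$\begin{aligned} I_3&=ABC,\\ I_3'&=A(a^2-4BC)+B(b^2-4AC)+C(c^2-4AB),\\ I_3''&=-4ABC+Aa^2+Bb^2+Cc^2-abc,\\ I_6&=(a^2-4BC)(b^2-4AC)(c^2-4AB).\end{aligned}$$ We say that $(Y,V)$ has invariants $\underline I=(I_3,I_3',I_3'',I_6)\in K^4$ if, for some standard model $Y_1$ of $(Y,V)$ and some $t\in k^*$, the invariants of $Y_1$ are $(t^{-1}I_3,\,t^{-1}I_3',\,t^{-1}I_3'',\,t^{-2}I_6)$,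 i.e. they define the same point as $\underline I$ in the weighted projective space $\mathbb P_{1,1,1,2}(k)$. For $\underline I\in K^4$ put $P=8I_3+I_3'-I_3''$ and let $Q$ be the discriminant of the cubic $$\mathcal P(T)=T^3-(I_3'+12I_3)\,T^2+\tfrac14\bigl(P^2+16I_3(P+I_3'')-I_6\bigr)T-I_3P^2\in K[T].$$ Let $(Y,V)$ be a Ciani quartic over $k$ with invariants $\underline I\in K^4$. Then $Y$ is special if and only if $Q=0$. Moreover, $$Q=-4I_3I_3'^3I_6-27I_3^2I_6^2+18I_3I_3'I_6I+I_3'^2I^2-4I^3,$$ where $I=\tfrac14\bigl(I_3'^2+I_3''^2-16I_3I_3''-2I_3'I_3''-I_6\bigr)$. -/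

import Mathlib

open scoped KaehlerDifferential

namespace Ciani

/-! ### Smooth plane quartics and their function fields -/

/-- A smooth plane quartic over an algebraically closed field `k`: a ternary quartic form `F` whose
partial derivatives have no common zero on the projective curve `F = 0`. -/
structure SmoothQuartic (k : Type*) [Field k] where
  /-- the quartic form -/
  form : MvPolynomial (Fin 3) k
  homogeneous : form.IsHomogeneous 4
  smooth : ∀ v : Fin 3 → k, v ≠ 0 → MvPolynomial.eval v form = 0 →
    ∃ i, MvPolynomial.eval v (MvPolynomial.pderiv i form) ≠ 0

/-- The affine equation `F(x, y, 1)`. -/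
noncomputable def dehomogenize {k : Type*} [Field k] (F : MvPolynomial (Fin 3) k) :
    MvPolynomial (Fin 2) k :=
  MvPolynomial.aeval ![MvPolynomial.X 0, MvPolynomial.X 1, 1] F

/-- `L` is the function field of the plane curve `F = 0`, with `x` and `y` the rational functions
`X / Z` and `Y / Z`: they generate `L` over `k`, and the polynomial relations between them are
exactly the multiples of `F(x, y, 1)`. That is, `L` is the fraction field of
`k[x, y] / (F(x, y, 1))`. -/
structure IsFunctionField {k : Type*} [Field k] {L : Type*} [Field L] [Algebra k L]
    (F : MvPolynomial (Fin 3) k) (x y : L) : Prop where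
  generates : IntermediateField.adjoin k {x, y} = ⊤
  relations : ∀ g : MvPolynomial (Fin 2) k,
    MvPolynomial.aeval ![x, y] g = 0 ↔ dehomogenize F ∣ g

/-! ### The genus of a function field -/

/-- The space `H⁰(X, Ω)` of regular differentials of the smooth projective curve `X` over the
algebraically closed field `k` with function field `F`. The local rings of `X` are the valuation
rings `O` of `F` that contain `k`, and `ω` is regular at `O` if it is an `O`-linear combination of
differentials `da` with `a ∈ O`. -/
def regularDifferentials (k F : Type*) [Field k] [Field F] [Algebra k F] :
    Submodule k (Ω[F⁄k]) where
  carrier := {ω | ∀ O : ValuationSubring F, (∀ c : k, algebraMap k F c ∈ O) →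
    ω ∈ Submodule.span O.toSubring (KaehlerDifferential.D k F '' (O : Set F))}
  zero_mem' := fun _ _ => Submodule.zero_mem _
  add_mem' := fun hω hη O hO => Submodule.add_mem _ (hω O hO) (hη O hO)
  smul_mem' := fun c ω hω O hO => by
    have h := Submodule.smul_mem _ (⟨algebraMap k F c, hO c⟩ : O.toSubring) (hω O hO)
    have e : (⟨algebraMap k F c, hO c⟩ : O.toSubring) • ω = c • ω := algebraMap_smul F c ω
    rwa [e] at h

/-- The genus of the smooth projective curve over the algebraically closed field `k` with function
field `F`: the dimension of its space of regular differentials. -/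
noncomputable def genus (k F : Type*) [Field k] [Field F] [Algebra k F] : Cardinal :=
  Module.rank k (regularDifferentials k F)

/-! ### Ciani subgroups -/

/-- Let `Y` be the smooth projective curve over `k` with function field `L`. Automorphisms of `Y`
are the same as `k`-automorphisms of `L`, and the quotient `Y / V` is the curve whose function field
is the fixed field of `V`. A Ciani subgroup is a subgroup `V ≃ C₂ × C₂` such that `Y / V` has genus
zero. -/
structure IsCianiSubgroup (k : Type*) {L : Type*} [Field k] [Field L] [Algebra k L]
    (V : Subgroup (L ≃ₐ[k] L)) : Prop where
  klein : IsKleinFour V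
  genus_quotient : genus k (IntermediateField.fixedField V) = 0

/-- The curve with function field `L` is special: it has more than one Ciani subgroup. -/
def IsSpecial (k L : Type*) [Field k] [Field L] [Algebra k L] : Prop :=
  ∃ V W : Subgroup (L ≃ₐ[k] L), IsCianiSubgroup k V ∧ IsCianiSubgroup k W ∧ V ≠ W

/-! ### Ciani invariants -/

/-- A tuple `(I₃, I₃', I₃'', I₆)`. -/
@[ext]
structure Invariants (K : Type*) where
  I3 : K
  I3' : K
  I3'' : K
  I6 : K

/-- The image of a tuple under a map of fields. -/
def Invariants.map {K k : Type*} (f : K → k) (I : Invariants K) : Invariants k :=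
  ⟨f I.I3, f I.I3', f I.I3'', f I.I6⟩

/-- Two tuples define the same point of the weighted projective space `ℙ(1, 1, 1, 2)`. -/
def Invariants.SamePoint {k : Type*} [Field k] (I J : Invariants k) : Prop :=
  ∃ t : k, t ≠ 0 ∧
    J = ⟨t * I.I3, t * I.I3', t * I.I3'', t ^ 2 * I.I6⟩

/-- The standard form `A X⁴ + B Y⁴ + C Z⁴ + a Y² Z² + b X² Z² + c X² Y²`. -/
noncomputable def standardForm {k : Type*} [Field k] (A B C a b c : k) : MvPolynomial (Fin 3) k :=
  MvPolynomial.C A * MvPolynomial.X 0 ^ 4 + MvPolynomial.C B * MvPolynomial.X 1 ^ 4 +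
    MvPolynomial.C C * MvPolynomial.X 2 ^ 4 +
    MvPolynomial.C a * MvPolynomial.X 1 ^ 2 * MvPolynomial.X 2 ^ 2 +
    MvPolynomial.C b * MvPolynomial.X 0 ^ 2 * MvPolynomial.X 2 ^ 2 +
    MvPolynomial.C c * MvPolynomial.X 0 ^ 2 * MvPolynomial.X 1 ^ 2

/-- The Ciani invariants of a standard form. -/
def standardInvariants {k : Type*} [Field k] (A B C a b c : k) : Invariants k where
  I3 := A * B * C
  I3' := A * (a ^ 2 - 4 * B * C) + B * (b ^ 2 - 4 * A * C) + C * (c ^ 2 - 4 * A * B)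
  I3'' := -4 * A * B * C + A * a ^ 2 + B * b ^ 2 + C * c ^ 2 - a * b * c
  I6 := (a ^ 2 - 4 * B * C) * (b ^ 2 - 4 * A * C) * (c ^ 2 - 4 * A * B)

/-- The smooth quartic given by the standard form with coefficients `A, B, C, a, b, c` is a standard
model of the pair `(Y, V)`, where `Y` is the curve with function field `L`: it is isomorphic to `Y`,
through coordinates in which `V` is the group of all `(x : y : z) ↦ (± x : ± y : ± z)`. -/
def IsStandardModel {k L : Type*} [Field k] [Field L] [Algebra k L]
    (V : Subgroup (L ≃ₐ[k] L)) (A B C a b c : k) : Prop :=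
  ∃ (Y₁ : SmoothQuartic k) (x y : L), Y₁.form = standardForm A B C a b c ∧
    IsFunctionField Y₁.form x y ∧
    ∀ σ : L ≃ₐ[k] L, σ ∈ V ↔ (σ x = x ∨ σ x = -x) ∧ (σ y = y ∨ σ y = -y)

/-- The pair `(Y, V)` has Ciani invariants `[I]`, as a point of weighted projective space. -/
def HasInvariants {k L : Type*} [Field k] [Field L] [Algebra k L]
    (V : Subgroup (L ≃ₐ[k] L)) (I : Invariants k) : Prop :=
  ∃ A B C a b c : k, IsStandardModel V A B C a b c ∧
    (standardInvariants A B C a b c).SamePoint I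

/-! ### The cubic and its discriminant -/

/-- `P = 8 I₃ + I₃' - I₃''`. -/
def Invariants.P {K : Type*} [Field K] (I : Invariants K) : K :=
  8 * I.I3 + I.I3' - I.I3''

/-- The coefficient `S₁`. -/
def Invariants.S₁ {K : Type*} [Field K] (I : Invariants K) : K :=
  I.I3' + 12 * I.I3

/-- The coefficient `S₂`. -/
def Invariants.S₂ {K : Type*} [Field K] (I : Invariants K) : K :=
  (I.P ^ 2 + 16 * I.I3 * (I.P + I.I3'') - I.I6) / 4

/-- The coefficient `S₃`. -/
def Invariants.S₃ {K : Type*} [Field K] (I : Invariants K) : K :=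
  I.I3 * I.P ^ 2

/-- The cubic `T³ - S₁ T² + S₂ T - S₃`. -/
noncomputable def Invariants.cubic {K : Type*} [Field K] (I : Invariants K) : Polynomial K :=
  Polynomial.X ^ 3 - Polynomial.C I.S₁ * Polynomial.X ^ 2 + Polynomial.C I.S₂ * Polynomial.X -
    Polynomial.C I.S₃

/-- The invariant `Q`, the discriminant of the cubic. -/
noncomputable def Invariants.Q {K : Type*} [Field K] (I : Invariants K) : K :=
  I.cubic.discr

/-- The auxiliary invariant `I`, as determined by the relation
`4 I + I₆ - I₃'² + 16 I₃ I₃'' + 2 I₃' I₃'' - I₃''² = 0`. -/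
def Invariants.aux {K : Type*} [Field K] (I : Invariants K) : K :=
  (I.I3' ^ 2 + I.I3'' ^ 2 - 16 * I.I3 * I.I3'' - 2 * I.I3' * I.I3'' - I.I6) / 4

end Ciani

/-! For a standard model one has `P = abc`, and the roots of the cubic are `Aa²`, `Bb²`, `Cc²`.
Hence `Q = 0` exactly when two of these three numbers agree (`standardInvariants_Q`), a condition
unaffected by weighted scaling. It remains to compare it with speciality on one standard model,
where `V` is the group of sign changes.

If there is a second Ciani subgroup, it contains an involution `σ` outside `V`. The regular
differentials of the quartic are the multiples of `ω = dx/f_y` by linear combinations of `1, x, y`;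
the action of `σ` on them shows that `σ` is induced by a matrix (`exists_matrix_of_involution`),
which preserves the quartic form up to a scalar (`exists_scalar_of_vanish`). Up to sign this matrix
is a reflection with a centre `u` and an axis `φ = 0`. Invariance says that `F(w + su)` is even in
`s` for `w` on the axis: thus the gradient of `F` at `u` is proportional to `φ`, and the polar cubic
of `u` vanishes on the axis. Since `σ` is not a sign change, `u` is not a coordinate vertex, and
then nonsingularity and explicit algebra force two of `Aa²`, `Bb²`, `Cc²` to agree
(`coeff_relation_of_polar`).

Conversely, if `Aa² = Bb²`, rescaling `y` makes the form symmetric in `x` and `y`, and the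
coordinates `x ± y` give another standard form with a different group of sign changes
(`isSpecial_of_relation`); the other two equalities reduce to this one by rotating the coordinates.
The quotient by a group of sign changes is a conic, hence has function field `k(t)`. The genus of
`k(t)` need not be computed: `V` is itself such a group and its quotient has genus zero by
assumption. -/

namespace Ciani

/-! ### The discriminant of the cubic -/

section Discriminant

variable {K : Type*} [Field K]

theorem Invariants.Q_eq_coeffs (I : Invariants K) :
    I.Q = I.S₁ ^ 2 * I.S₂ ^ 2 - 4 * I.S₂ ^ 3 - 4 * I.S₁ ^ 3 * I.S₃ - 27 * I.S₃ ^ 2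
      + 18 * I.S₁ * I.S₂ * I.S₃ := by
  have e : I.cubic = Polynomial.C 1 * Polynomial.X ^ 3 + Polynomial.C (-I.S₁) * Polynomial.X ^ 2 +
      Polynomial.C I.S₂ * Polynomial.X + Polynomial.C (-I.S₃) := by
    simp only [Invariants.cubic, map_neg, map_one]; ring
  have hd : I.cubic.degree = 3 := by
    rw [e]; exact Polynomial.degree_cubic one_ne_zero
  rw [Invariants.Q, Polynomial.discr_of_degree_eq_three hd, e]
  simp [Polynomial.coeff_X, Polynomial.coeff_C]
  ring

theorem Invariants.Q_formula (h2 : (2 : K) ≠ 0) (I : Invariants K) :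
    I.Q = -4 * I.I3 * I.I3' ^ 3 * I.I6 - 27 * I.I3 ^ 2 * I.I6 ^ 2
        + 18 * I.I3 * I.I3' * I.I6 * I.aux + I.I3' ^ 2 * I.aux ^ 2 - 4 * I.aux ^ 3 := by
  have h4 : (4 : K) ≠ 0 := by
    have : (4 : K) = 2 * 2 := by norm_num
    rw [this]; exact mul_ne_zero h2 h2
  rw [I.Q_eq_coeffs]
  simp only [Invariants.S₁, Invariants.S₂, Invariants.S₃, Invariants.aux, Invariants.P]
  field_simp
  ring

theorem Invariants.Q_map {k : Type*} [Field k] (f : K →+* k) (I : Invariants K) :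
    (I.map f).Q = f I.Q := by
  simp only [Invariants.Q_eq_coeffs, Invariants.S₁, Invariants.S₂, Invariants.S₃, Invariants.P,
    Invariants.map, map_add, map_sub, map_mul, map_pow, map_div₀, map_ofNat]

/-- `Q` is weighted homogeneous of degree 6. -/
theorem Invariants.SamePoint.Q_eq_zero_iff {I J : Invariants K} (h : I.SamePoint J) :
    J.Q = 0 ↔ I.Q = 0 := by
  obtain ⟨t, ht, rfl⟩ := h
  have : (⟨t * I.I3, t * I.I3', t * I.I3'', t ^ 2 * I.I6⟩ : Invariants K).Q = t ^ 6 * I.Q := by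
    simp only [Invariants.Q_eq_coeffs, Invariants.S₁, Invariants.S₂, Invariants.S₃, Invariants.P]
    ring
  rw [this, mul_eq_zero]
  simp [ht]

/-- Here `P = abc`, so `S₁`, `S₂`, `S₃` are the elementary symmetric functions of `Aa²`, `Bb²`,
`Cc²`. -/
theorem standardInvariants_Q (h2 : (2 : K) ≠ 0) (A B C a b c : K) :
    (standardInvariants A B C a b c).Q =
      ((A * a ^ 2 - B * b ^ 2) * (B * b ^ 2 - C * c ^ 2) * (A * a ^ 2 - C * c ^ 2)) ^ 2 := by
  have h4 : (4 : K) ≠ 0 := by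
    have : (4 : K) = 2 * 2 := by norm_num
    rw [this]; exact mul_ne_zero h2 h2
  have e : (standardInvariants A B C a b c).S₂ =
      A * a ^ 2 * (B * b ^ 2) + B * b ^ 2 * (C * c ^ 2) + A * a ^ 2 * (C * c ^ 2) := by
    simp only [Invariants.S₂, Invariants.P, standardInvariants]
    field_simp
    ring
  rw [Invariants.Q_eq_coeffs, e]
  simp only [Invariants.S₁, Invariants.S₃, Invariants.P, standardInvariants]
  ring

theorem standardInvariants_Q_eq_zero_iff (h2 : (2 : K) ≠ 0) (A B C a b c : K) :
    (standardInvariants A B C a b c).Q = 0 ↔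
      A * a ^ 2 = B * b ^ 2 ∨ B * b ^ 2 = C * c ^ 2 ∨ C * c ^ 2 = A * a ^ 2 := by
  rw [standardInvariants_Q h2, pow_eq_zero_iff two_ne_zero, mul_eq_zero, mul_eq_zero, sub_eq_zero,
    sub_eq_zero, sub_eq_zero, or_assoc, eq_comm (a := A * a ^ 2) (b := C * c ^ 2)]

end Discriminant

/-! ### Coefficient relations forced by a reflection -/

section Reflections

variable {k : Type*} [Field k]

/-- Half the polar cubic of the standard form with respect to the point `u`. -/
def halfPolar (A B C a b c : k) (u w : Fin 3 → k) : k :=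
  u 0 * w 0 * (2 * A * w 0 ^ 2 + c * w 1 ^ 2 + b * w 2 ^ 2) +
    u 1 * w 1 * (c * w 0 ^ 2 + 2 * B * w 1 ^ 2 + a * w 2 ^ 2) +
    u 2 * w 2 * (b * w 0 ^ 2 + a * w 1 ^ 2 + 2 * C * w 2 ^ 2)

/-- The case of a centre `(r : s : 0)` on a coordinate line. Half the gradient there is `(rα, sβ,
0)`, so the points `(sβ, -rα, z)` lie on the axis. The `z²` term of the polar gives `bβ = aα`; its
value at `z = 0` factors and gives `Ap² = Bq²`, that is `pα = qβ`. Eliminating `α` and `β` gives `bp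
= aq`, and the relation follows. -/
theorem coeff_relation_of_polar_two {A B C a b c p q r s α β : k} (h2 : (2 : k) ≠ 0)
    (hc : c ^ 2 ≠ 4 * A * B) (hr : r ≠ 0) (hs : s ≠ 0) (hp : p = r ^ 2) (hq : q = s ^ 2)
    (hα : α = 2 * A * p + c * q) (hβ : β = c * p + 2 * B * q) (hN : p * α + q * β ≠ 0)
    (h : ∀ z : k, halfPolar A B C a b c ![r, s, 0] ![s * β, -(r * α), z] = 0) :
    A * a ^ 2 = B * b ^ 2 := by
  have hp0 : p ≠ 0 := by rw [hp]; positivity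
  have hq0 : q ≠ 0 := by rw [hq]; positivity
  have h0 := h 0
  have h1 := h 1
  simp [halfPolar] at h0 h1
  have e1 : b * β = a * α := by
    apply mul_left_cancel₀ (mul_ne_zero hr hs)
    linear_combination h1 - h0
  have e2 : A * p ^ 2 = B * q ^ 2 := by
    have : r * s * (2 * (A * p ^ 2 - B * q ^ 2) * (p * α + q * β) * (c ^ 2 - 4 * A * B)) = 0 := by
      have h0' : r * s * (β * (2 * A * q * β ^ 2 + c * p * α ^ 2) -
          α * (c * q * β ^ 2 + 2 * B * p * α ^ 2)) = 0 := by
        rw [hp, hq]; linear_combination h0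
      rw [← h0', hα, hβ]; ring
    have h3 : c ^ 2 - 4 * A * B ≠ 0 := sub_ne_zero.mpr hc
    simpa [hr, hs, h2, hN, h3, sub_eq_zero] using this
  have e3 : p * α = q * β := by rw [hα, hβ]; linear_combination 2 * e2
  have hβ0 : β ≠ 0 := by
    rintro rfl
    apply hN
    rw [e3]; ring
  have e4 : b * p = a * q := by
    apply mul_right_cancel₀ hβ0
    linear_combination p * e1 + a * e3
  apply mul_left_cancel₀ (pow_ne_zero 2 hq0)
  linear_combination (-A * (a * q + b * p)) * e4 + b ^ 2 * e2

/-- The case of centre `(1 : 1 : 1)`, with half-gradient `(α, β, γ)`. If two of `α, β, γ` agree, the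
form is symmetric in the corresponding variables. Otherwise the polar conditions, linear in the
coefficients once `α, β, γ` are fixed, have a unique solution, the double conic `(αx² + βy² + γz²)²
/ 2N`; this contradicts `a² ≠ 4BC`. -/
theorem coeff_relation_of_polar_ones {A B C a b c α β γ : k} (h2 : (2 : k) ≠ 0)
    (ha : a ^ 2 ≠ 4 * B * C)
    (hα : α = 2 * A + c + b) (hβ : β = c + 2 * B + a) (hγ : γ = b + a + 2 * C)
    (hN : α + β + γ ≠ 0)
    (h12 : β * (2 * A * β ^ 2 + c * α ^ 2) = α * (c * β ^ 2 + 2 * B * α ^ 2))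
    (h13 : γ * (2 * A * γ ^ 2 + b * α ^ 2) = α * (b * γ ^ 2 + 2 * C * α ^ 2))
    (h23 : γ * (2 * B * γ ^ 2 + a * β ^ 2) = β * (a * γ ^ 2 + 2 * C * β ^ 2))
    (hα0 : α ≠ 0) (hβ0 : β ≠ 0) (hγ0 : γ ≠ 0) :
    A * a ^ 2 = B * b ^ 2 ∨ B * b ^ 2 = C * c ^ 2 ∨ C * c ^ 2 = A * a ^ 2 := by
  by_cases hαβ : α = β
  · left
    have e : A = B := by
      apply mul_left_cancel₀ (mul_ne_zero h2 (pow_ne_zero 3 hα0))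
      rw [← hαβ] at h12
      linear_combination h12
    have e' : a = b := by linear_combination -hαβ + hα - hβ + 2 * e
    rw [e, e']
  by_cases hβγ : β = γ
  · right; left
    have e : B = C := by
      apply mul_left_cancel₀ (mul_ne_zero h2 (pow_ne_zero 3 hβ0))
      rw [← hβγ] at h23
      linear_combination h23
    have e' : b = c := by linear_combination -hβγ + hβ - hγ + 2 * e
    rw [e, e']
  by_cases hαγ : α = γ
  · right; right
    have e : A = C := by
      apply mul_left_cancel₀ (mul_ne_zero h2 (pow_ne_zero 3 hα0))
      rw [← hαγ] at h13
      linear_combination h13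
    have e' : a = c := by linear_combination -hαγ + hα - hγ + 2 * e
    rw [e, e']
  exfalso
  have d1 := sub_ne_zero.mpr hαβ
  have d2 := sub_ne_zero.mpr hβγ
  have d3 := sub_ne_zero.mpr hαγ
  obtain ⟨N, hNdef⟩ : ∃ N, N = α + β + γ := ⟨_, rfl⟩
  rw [← hNdef] at hN
  -- Eliminating `A, B, C` leaves three linear equations in `a, b, c`, solved by the double conic
  -- `Na = βγ`, `Nb = αγ`, `Nc = αβ`. The deviations `a', b', c'` from it satisfy the homogeneous
  -- system `l1`, `l2`, `l3`.
  obtain ⟨a', ha'⟩ : ∃ a', a' = N * a - β * γ := ⟨_, rfl⟩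
  obtain ⟨b', hb'⟩ : ∃ b', b' = N * b - α * γ := ⟨_, rfl⟩
  obtain ⟨c', hc'⟩ : ∃ c', c' = N * c - α * β := ⟨_, rfl⟩
  have l1 : c' * ((β - α) * (α + β) ^ 2) + b' * β ^ 3 - a' * α ^ 3 = 0 := by
    rw [ha', hb', hc']
    linear_combination -N * h12 - N * β ^ 3 * hα + N * α ^ 3 * hβ
      + (α * β * (β - α) * (α + β)) * hNdef
  have l2 : b' * ((γ - α) * (α + γ) ^ 2) + c' * γ ^ 3 - a' * α ^ 3 = 0 := by
    rw [ha', hb', hc']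
    linear_combination -N * h13 - N * γ ^ 3 * hα + N * α ^ 3 * hγ
      + (α * γ * (γ - α) * (α + γ)) * hNdef
  have l3 : a' * ((γ - β) * (β + γ) ^ 2) + c' * γ ^ 3 - b' * β ^ 3 = 0 := by
    rw [ha', hb', hc']
    linear_combination -N * h23 - N * γ ^ 3 * hβ + N * β ^ 3 * hγ
      + (β * γ * (γ - β) * (β + γ)) * hNdef
  -- Up to sign this is the determinant of the system; the combinations below are expansions by
  -- cofactors.
  have hdet : N ^ 3 * (α * β * γ) * ((α - β) * (β - γ) * (α - γ)) ≠ 0 := by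
    simp [hN, hα0, hβ0, hγ0, d1, d2, d3]
  have ha0 : a' = 0 := by
    apply (mul_eq_zero.mp _).resolve_left hdet
    rw [hNdef]
    linear_combination ((γ - α) * (α + γ) ^ 2 * γ ^ 3 + γ ^ 3 * β ^ 3) * l1
      - (β ^ 3 * γ ^ 3 + (β - α) * (α + β) ^ 2 * β ^ 3) * l2
      + (β ^ 3 * γ ^ 3 - (β - α) * (α + β) ^ 2 * ((γ - α) * (α + γ) ^ 2)) * l3
  have hb0 : b' = 0 := by
    apply (mul_eq_zero.mp _).resolve_left hdet
    rw [hNdef]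
    linear_combination (α ^ 3 * γ ^ 3 + γ ^ 3 * ((γ - β) * (β + γ) ^ 2)) * l1
      - (α ^ 3 * γ ^ 3 + (β - α) * (α + β) ^ 2 * ((γ - β) * (β + γ) ^ 2)) * l2
      + (α ^ 3 * γ ^ 3 - (β - α) * (α + β) ^ 2 * α ^ 3) * l3
  have hc0 : c' = 0 := by
    rw [ha0, hb0] at l2
    simpa [hγ0] using l2
  apply ha
  have e1 : N * a = β * γ := by linear_combination -ha' + ha0
  have e2 : N * b = α * γ := by linear_combination -hb' + hb0
  have e3 : N * c = α * β := by linear_combination -hc' + hc0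
  have e4 : 2 * N * B = β ^ 2 := by linear_combination -N * hβ - e3 - e1 + β * hNdef
  have e5 : 2 * N * C = γ ^ 2 := by linear_combination -N * hγ - e1 - e2 + γ * hNdef
  apply mul_left_cancel₀ (pow_ne_zero 2 hN)
  linear_combination (N * a + β * γ) * e1 - 2 * N * C * e4 - β ^ 2 * e5

/-- A plane involution that is a reflection with centre `u` and preserves a smooth standard form
forces two of `A a²`, `B b²`, `C c²` to agree, unless `u` is a vertex of the coordinate triangle. -/
theorem coeff_relation_of_polar {A B C a b c : k} (h2 : (2 : k) ≠ 0)
    (hA : A ≠ 0) (hB : B ≠ 0) (hC : C ≠ 0)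
    (ha : a ^ 2 ≠ 4 * B * C) (hb : b ^ 2 ≠ 4 * A * C) (hc : c ^ 2 ≠ 4 * A * B)
    (u φ : Fin 3 → k)
    (h0 : φ 0 = u 0 * (2 * A * u 0 ^ 2 + c * u 1 ^ 2 + b * u 2 ^ 2))
    (h1 : φ 1 = u 1 * (c * u 0 ^ 2 + 2 * B * u 1 ^ 2 + a * u 2 ^ 2))
    (h3 : φ 2 = u 2 * (b * u 0 ^ 2 + a * u 1 ^ 2 + 2 * C * u 2 ^ 2))
    (hN : u 0 * φ 0 + u 1 * φ 1 + u 2 * φ 2 ≠ 0)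
    (hG : ∀ w : Fin 3 → k, φ 0 * w 0 + φ 1 * w 1 + φ 2 * w 2 = 0 → halfPolar A B C a b c u w = 0)
    (hu : ¬ (u 0 = 0 ∧ u 1 = 0) ∧ ¬ (u 0 = 0 ∧ u 2 = 0) ∧ ¬ (u 1 = 0 ∧ u 2 = 0)) :
    A * a ^ 2 = B * b ^ 2 ∨ B * b ^ 2 = C * c ^ 2 ∨ C * c ^ 2 = A * a ^ 2 := by
  obtain ⟨hu01, hu02, hu12⟩ := hu
  by_cases z2 : u 2 = 0
  · left
    have z0 : u 0 ≠ 0 := fun h => hu02 ⟨h, z2⟩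
    have z1 : u 1 ≠ 0 := fun h => hu12 ⟨h, z2⟩
    refine coeff_relation_of_polar_two (C := C) (r := u 0) (s := u 1) h2 hc z0 z1 rfl rfl rfl rfl ?_ ?_
    · convert hN using 1
      rw [h0, h1, h3, z2]; ring
    · intro z
      refine Eq.trans ?_ (hG ![u 1 * (c * u 0 ^ 2 + 2 * B * u 1 ^ 2), -(u 0 * (2 * A * u 0 ^ 2 + c * u 1 ^ 2)), z] ?_)
      · simp [halfPolar, z2]
      · simp [h0, h1, h3, z2]; ring
  by_cases z0 : u 0 = 0
  · right; left
    have z1 : u 1 ≠ 0 := fun h => hu01 ⟨z0, h⟩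
    refine coeff_relation_of_polar_two (A := B) (B := C) (C := A) (a := b) (b := c) (c := a)
      (r := u 1) (s := u 2) h2 ha z1 z2 rfl rfl rfl rfl ?_ ?_
    · convert hN using 1
      rw [h0, h1, h3, z0]; ring
    · intro z
      refine Eq.trans ?_ (hG ![z, u 2 * (a * u 1 ^ 2 + 2 * C * u 2 ^ 2), -(u 1 * (2 * B * u 1 ^ 2 + a * u 2 ^ 2))] ?_)
      · simp [halfPolar, z0]; ring
      · simp [h0, h1, h3, z0]; ring
  by_cases z1 : u 1 = 0
  · right; right
    refine coeff_relation_of_polar_two (A := C) (B := A) (C := B) (a := c) (b := a) (c := b)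
      (r := u 2) (s := u 0) h2 (by rw [mul_right_comm]; exact hb) z2 z0 rfl rfl rfl rfl ?_ ?_
    · convert hN using 1
      rw [h0, h1, h3, z1]; ring
    · intro z
      refine Eq.trans ?_ (hG ![-(u 2 * (2 * C * u 2 ^ 2 + b * u 0 ^ 2)), z, u 0 * (b * u 2 ^ 2 + 2 * A * u 0 ^ 2)] ?_)
      · simp [halfPolar, z1]; ring
      · simp [h0, h1, h3, z1]; ring
  obtain ⟨r, hr⟩ : ∃ r, r = u 0 := ⟨_, rfl⟩
  obtain ⟨s, hs⟩ : ∃ s, s = u 1 := ⟨_, rfl⟩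
  obtain ⟨t, ht⟩ : ∃ t, t = u 2 := ⟨_, rfl⟩
  rw [← hr] at z0 h0 h1 h3 hN
  rw [← hs] at z1 h0 h1 h3 hN
  rw [← ht] at z2 h0 h1 h3 hN
  obtain ⟨α, hα⟩ : ∃ α, α = r * φ 0 := ⟨_, rfl⟩
  obtain ⟨β, hβ⟩ : ∃ β, β = s * φ 1 := ⟨_, rfl⟩
  obtain ⟨γ, hγ⟩ : ∃ γ, γ = t * φ 2 := ⟨_, rfl⟩
  -- The axis is tested at its intersections with the three coordinate lines.
  have k12 := hG ![r * β, -(s * α), 0] (by simp [hα, hβ]; ring)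
  have k13 := hG ![r * γ, 0, -(t * α)] (by simp [hα, hγ]; ring)
  have k23 := hG ![0, s * γ, -(t * β)] (by simp [hβ, hγ]; ring)
  simp only [halfPolar, ← hr, ← hs, ← ht, Matrix.cons_val_zero, Matrix.cons_val_one,
    Matrix.cons_val] at k12 k13 k23
  rw [← hα, ← hβ, ← hγ] at hN
  rw [h0] at hα
  rw [h1] at hβ
  rw [h3] at hγ
  by_cases hα0 : α = 0
  · rw [hα0] at k12 k13
    have hβ0 : β = 0 := by simpa [h2, hA, z0] using k12
    have hγ0 : γ = 0 := by simpa [h2, hA, z0] using k13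
    simp [hα0, hβ0, hγ0] at hN
  by_cases hβ0 : β = 0
  · rw [hβ0] at k12 k23
    have hα0 : α = 0 := by simpa [h2, hB, z1] using k12
    have hγ0 : γ = 0 := by simpa [h2, hB, z1] using k23
    simp [hα0, hβ0, hγ0] at hN
  by_cases hγ0 : γ = 0
  · rw [hγ0] at k13 k23
    have hα0 : α = 0 := by simpa [h2, hC, z2] using k13
    have hβ0 : β = 0 := by simpa [h2, hC, z2] using k23
    simp [hα0, hβ0, hγ0] at hN
  have hscale : ∀ {X Y : k}, (r * s * t) ^ 4 * X = (r * s * t) ^ 4 * Y → X = Y := fun h =>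
    mul_left_cancel₀ (pow_ne_zero 4 (mul_ne_zero (mul_ne_zero z0 z1) z2)) h
  -- Scaling the coordinates by `r, s, t` moves the centre to `(1 : 1 : 1)` and multiplies each of
  -- `Aa²`, `Bb²`, `Cc²` by `(rst)⁴`.
  have key := coeff_relation_of_polar_ones (A := A * r ^ 4) (B := B * s ^ 4) (C := C * t ^ 4)
    (a := a * s ^ 2 * t ^ 2) (b := b * r ^ 2 * t ^ 2) (c := c * r ^ 2 * s ^ 2) (α := α) (β := β)
    (γ := γ) h2
    (fun h => ha (mul_left_cancel₀ (pow_ne_zero 4 (mul_ne_zero z1 z2)) (by linear_combination h)))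
    (by rw [hα]; ring) (by rw [hβ]; ring) (by rw [hγ]; ring) hN
    (by linear_combination k12) (by linear_combination k13) (by linear_combination k23) hα0 hβ0 hγ0
  refine key.imp (fun h => hscale ?_) (Or.imp (fun h => hscale ?_) (fun h => hscale ?_)) <;>
  linear_combination h

end Reflections

/-! ### Linear involutions preserving a standard form -/

section Involutions

variable {k : Type*} [Field k]

/-- The value of the standard form at a point. -/
def standardValue {k : Type*} [CommRing k] (A B C a b c : k) (v : Fin 3 → k) : k :=
  A * v 0 ^ 4 + B * v 1 ^ 4 + C * v 2 ^ 4 + a * v 1 ^ 2 * v 2 ^ 2 + b * v 0 ^ 2 * v 2 ^ 2 +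
    c * v 0 ^ 2 * v 1 ^ 2

theorem quartic_coeffs_eq_zero [Infinite k] {p q r s t : k}
    (h : ∀ x : k, p * x ^ 4 + q * x ^ 3 + r * x ^ 2 + s * x + t = 0) :
    p = 0 ∧ q = 0 ∧ r = 0 ∧ s = 0 ∧ t = 0 := by
  open Polynomial in
  have e : C p * X ^ 4 + C q * X ^ 3 + C r * X ^ 2 + C s * X + C t = (0 : k[X]) :=
    Polynomial.funext fun x => by simpa using h x
  refine ⟨?_, ?_, ?_, ?_, ?_⟩
  · simpa [Polynomial.coeff_X, Polynomial.coeff_C] using congrArg (Polynomial.coeff · 4) e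
  · simpa [Polynomial.coeff_X, Polynomial.coeff_C] using congrArg (Polynomial.coeff · 3) e
  · simpa [Polynomial.coeff_X, Polynomial.coeff_C] using congrArg (Polynomial.coeff · 2) e
  · simpa [Polynomial.coeff_X, Polynomial.coeff_C] using congrArg (Polynomial.coeff · 1) e
  · simpa [Polynomial.coeff_X, Polynomial.coeff_C] using congrArg (Polynomial.coeff · 0) e

/-- The `x⁴` coefficient is the quadratic `A + bT + CT²` at `T = l²`, and the `x³y` coefficient is
`2lm` times its derivative there. If both vanish with `lm ≠ 0`, the quadratic has discriminant zero;
`l = 0` would give `A = 0`, and `m = 0` would give `B = 0`. -/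
theorem standardValue_not_vanish_on_graph [Infinite k] {A B C a b c l m : k} (h2 : (2 : k) ≠ 0)
    (hA : A ≠ 0) (hB : B ≠ 0) (hb : b ^ 2 ≠ 4 * A * C)
    (h : ∀ x y : k, standardValue A B C a b c ![x, y, l * x + m * y] = 0) : False := by
  obtain ⟨h4, h3, -, -, h0⟩ := quartic_coeffs_eq_zero (p := A + C * l ^ 4 + b * l ^ 2)
    (q := 4 * C * l ^ 3 * m + 2 * b * l * m)
    (r := 6 * C * l ^ 2 * m ^ 2 + a * l ^ 2 + b * m ^ 2 + c)
    (s := 4 * C * l * m ^ 3 + 2 * a * l * m) (t := B + C * m ^ 4 + a * m ^ 2) (fun x => by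
      have := h x 1
      simp [standardValue] at this
      linear_combination this)
  have hl : l ≠ 0 := by rintro rfl; simp [hA] at h4
  have hm : m ≠ 0 := by rintro rfl; simp [hB] at h0
  have e : 2 * C * l ^ 2 = -b := by
    apply mul_left_cancel₀ (mul_ne_zero h2 (mul_ne_zero hl hm))
    linear_combination h3
  apply hb
  linear_combination -4 * C * h4 + (2 * C * l ^ 2 + b) * e

theorem standardValue_not_vanish_on_plane [Infinite k] {A B C a b c : k} (h2 : (2 : k) ≠ 0)
    (hA : A ≠ 0) (hB : B ≠ 0) (hC : C ≠ 0)
    (hb : b ^ 2 ≠ 4 * A * C) (hc : c ^ 2 ≠ 4 * A * B)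
    (φ : Fin 3 → k) (hφ : φ ≠ 0)
    (h : ∀ v : Fin 3 → k, φ ⬝ᵥ v = 0 → standardValue A B C a b c v = 0) : False := by
  by_cases z2 : φ 2 = 0
  · by_cases z1 : φ 1 = 0
    · have z0 : φ 0 ≠ 0 := fun z0 => hφ (by ext i; fin_cases i <;> assumption)
      refine standardValue_not_vanish_on_graph (A := C) (B := B) (C := A) (a := c) (b := b)
        (c := a) (l := 0) (m := 0) h2 hC hB (by rwa [mul_right_comm]) fun x y => ?_
      have := h ![0, y, x] (by rw [Matrix.vec3_dotProduct]; simp [z1, z2])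
      simp [standardValue] at this ⊢
      linear_combination this
    · refine standardValue_not_vanish_on_graph (A := A) (B := C) (C := B) (a := a) (b := c)
        (c := b) (l := - φ 0 / φ 1) (m := - φ 2 / φ 1) h2 hA hC hc fun x y => ?_
      have := h ![x, - φ 0 / φ 1 * x + - φ 2 / φ 1 * y, y]
        (by rw [Matrix.vec3_dotProduct]; simp; field_simp; ring)
      simp [standardValue] at this ⊢
      linear_combination this
  · refine standardValue_not_vanish_on_graph (A := A) (B := B) (C := C) (a := a) (b := b)
        (c := c) (l := - φ 0 / φ 2) (m := - φ 1 / φ 2) h2 hA hB hb fun x y => ?_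
    exact h _ (by rw [Matrix.vec3_dotProduct]; simp; field_simp; ring)

/-- Since `M² = 1`, each `Mv - v` lies in the `-1` eigenspace, which is spanned by one vector `u`.
-/
theorem exists_rank_one_of_finrank_le_one {M : Matrix (Fin 3) (Fin 3) k} (hM : M * M = 1)
    (h : Module.finrank k (LinearMap.ker (Matrix.toLin' (M + 1))) ≤ 1) :
    ∃ u φ : Fin 3 → k, M.mulVec u = -u ∧ ∀ v, M.mulVec v = v + (φ ⬝ᵥ v) • u := by
  obtain ⟨⟨u, hu⟩, hspan⟩ := finrank_le_one_iff.mp h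
  have hker : ∀ v, M.mulVec v - v ∈ LinearMap.ker (Matrix.toLin' (M + 1)) := by
    intro v
    rw [LinearMap.mem_ker, Matrix.toLin'_apply, Matrix.mulVec_sub, Matrix.add_mulVec,
      Matrix.add_mulVec, Matrix.mulVec_mulVec, hM, Matrix.one_mulVec, Matrix.one_mulVec]
    abel
  have hc : ∀ v, ∃ c : k, M.mulVec v - v = c • u := by
    intro v
    obtain ⟨c, hc⟩ := hspan ⟨_, hker v⟩
    exact ⟨c, (congrArg Subtype.val hc).symm⟩
  choose f hf using hc
  refine ⟨u, fun j => f (Pi.single j 1), ?_, fun v => ?_⟩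
  · rw [LinearMap.mem_ker, Matrix.toLin'_apply, Matrix.add_mulVec, Matrix.one_mulVec] at hu
    exact eq_neg_of_add_eq_zero_left hu
  · have hv : v = ∑ j, v j • Pi.single j (1 : k) := by
      ext i; simp [Finset.sum_apply, Pi.single_apply]
    have : M.mulVec v - v = ((fun j => f (Pi.single j 1)) ⬝ᵥ v) • u := by
      conv_lhs => rw [hv]
      rw [Matrix.mulVec_sum, ← Finset.sum_sub_distrib, dotProduct, Finset.sum_smul]
      refine Finset.sum_congr rfl fun j _ => ?_
      rw [Matrix.mulVec_smul, ← smul_sub, hf, smul_smul, mul_comm]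
    rw [← this]; abel

/-- Up to sign, an involution of a three-dimensional space is the identity or a reflection. -/
theorem exists_rank_one_of_involution (h2 : (2 : k) ≠ 0) {M : Matrix (Fin 3) (Fin 3) k}
    (hM : M * M = 1) :
    ∃ N u φ, (N = M ∨ N = -M) ∧ N.mulVec u = -u ∧
      ∀ v : Fin 3 → k, N.mulVec v = v + (φ ⬝ᵥ v) • u := by
  -- The `+1` and `-1` eigenspaces meet trivially, so their dimensions add to at most 3 and one of
  -- them is at most 1. Replacing `M` by `-M` exchanges them.
  have hdisj : LinearMap.ker (Matrix.toLin' (M + 1)) ⊓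
      LinearMap.ker (Matrix.toLin' (-M + 1)) = ⊥ := by
    rw [eq_bot_iff]
    rintro v ⟨h1, h1'⟩
    simp only [SetLike.mem_coe, LinearMap.mem_ker, Matrix.toLin'_apply, Matrix.add_mulVec,
      Matrix.neg_mulVec, Matrix.one_mulVec] at h1 h1'
    have : (2 : k) • v = 0 := by
      rw [two_smul]; calc v + v = (M.mulVec v + v) + (-M.mulVec v + v) := by abel
        _ = 0 := by rw [h1, h1', add_zero]
    simpa [h2] using this
  have hsum := Submodule.finrank_sup_add_finrank_inf_eq (LinearMap.ker (Matrix.toLin' (M + 1)))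
    (LinearMap.ker (Matrix.toLin' (-M + 1)))
  rw [hdisj, finrank_bot, add_zero] at hsum
  have hle := Submodule.finrank_le (LinearMap.ker (Matrix.toLin' (M + 1)) ⊔
    LinearMap.ker (Matrix.toLin' (-M + 1)))
  rw [Module.finrank_fin_fun] at hle
  rcases Nat.lt_or_ge 1 (Module.finrank k (LinearMap.ker (Matrix.toLin' (M + 1)))) with h | h
  · obtain ⟨u, φ, h1, h3⟩ := exists_rank_one_of_finrank_le_one (M := -M) (by simpa using hM)
      (by omega)
    exact ⟨-M, u, φ, Or.inr rfl, h1, h3⟩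
  · obtain ⟨u, φ, h1, h3⟩ := exists_rank_one_of_finrank_le_one hM h
    exact ⟨M, u, φ, Or.inl rfl, h1, h3⟩

/-- A linear involution that is not a diagonal matrix and preserves a smooth standard form up to
a scalar forces two of `A a²`, `B b²`, `C c²` to agree. -/
theorem coeff_relation_of_involution [IsAlgClosed k] {A B C a b c : k} (h2 : (2 : k) ≠ 0)
    (hA : A ≠ 0) (hB : B ≠ 0) (hC : C ≠ 0)
    (ha : a ^ 2 ≠ 4 * B * C) (hb : b ^ 2 ≠ 4 * A * C) (hc : c ^ 2 ≠ 4 * A * B)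
    (hsm : ∀ u : Fin 3 → k, u ≠ 0 →
      ¬ (u 0 * (2 * A * u 0 ^ 2 + c * u 1 ^ 2 + b * u 2 ^ 2) = 0 ∧
        u 1 * (c * u 0 ^ 2 + 2 * B * u 1 ^ 2 + a * u 2 ^ 2) = 0 ∧
        u 2 * (b * u 0 ^ 2 + a * u 1 ^ 2 + 2 * C * u 2 ^ 2) = 0))
    {M : Matrix (Fin 3) (Fin 3) k} (hM : M * M = 1) (hdiag : ∃ i j, i ≠ j ∧ M i j ≠ 0)
    {d : k} (hF : ∀ v, standardValue A B C a b c (M.mulVec v) = d * standardValue A B C a b c v) :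
    A * a ^ 2 = B * b ^ 2 ∨ B * b ^ 2 = C * c ^ 2 ∨ C * c ^ 2 = A * a ^ 2 := by
  obtain ⟨N, u, φ, hNM, hNu, hN⟩ := exists_rank_one_of_involution h2 hM
  have hFN : ∀ v, standardValue A B C a b c (N.mulVec v) = d * standardValue A B C a b c v := by
    rcases hNM with rfl | rfl
    · exact hF
    · intro v
      rw [← hF v]
      simp [standardValue, Matrix.neg_mulVec, Even.neg_pow (show Even 4 by decide)]
  obtain ⟨i, j, hij, hMij⟩ := hdiag
  have hentry : ∀ i j, i ≠ j → N i j = φ j * u i := by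
    intro i j hij
    have := congrFun (hN (Pi.single j 1)) i
    simpa [hij] using this
  have huφ : ∃ i j, i ≠ j ∧ φ j * u i ≠ 0 := by
    refine ⟨i, j, hij, ?_⟩
    rw [← hentry i j hij]
    rcases hNM with rfl | rfl
    · exact hMij
    · simpa using hMij
  obtain ⟨i', j', -, hne⟩ := huφ
  have hu0 : u ≠ 0 := by rintro rfl; simp at hne
  have hφ0 : φ ≠ 0 := by rintro rfl; simp at hne
  have hφu : φ ⬝ᵥ u = -2 := by
    have h := hN u
    rw [hNu] at h
    have : (φ ⬝ᵥ u + 2) • u = 0 := by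
      rw [add_smul, two_smul]
      calc (φ ⬝ᵥ u) • u + (u + u) = (u + (φ ⬝ᵥ u) • u) + u := by abel
        _ = 0 := by rw [← h]; simp
    exact eq_neg_of_add_eq_zero_left ((smul_eq_zero.mp this).resolve_right hu0)
  have : Infinite k := IsAlgClosed.instInfinite
  -- The plane `φ = 0` is fixed pointwise, so `d ≠ 1` would make the form vanish on it.
  have hd : d = 1 := by
    by_contra hd
    refine standardValue_not_vanish_on_plane h2 hA hB hC hb hc φ hφ0
      (a := a) fun v hv => ?_
    have h := hFN v
    rw [hN, hv, zero_smul, add_zero] at h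
    have : (d - 1) * standardValue A B C a b c v = 0 := by linear_combination -h
    exact (mul_eq_zero.mp this).resolve_left (sub_ne_zero.mpr hd)
  -- `N` sends `w + su` to `w - su`, so the odd part of the form in `s` vanishes; it is twice the
  -- expression here after division by 2.
  have heven : ∀ w, φ ⬝ᵥ w = 0 → ∀ s : k,
      s * (halfPolar A B C a b c u w + s ^ 2 * halfPolar A B C a b c w u) = 0 := by
    intro w hw s
    have h := hFN (w + s • u)
    rw [hN, hd, one_mul, dotProduct_add, hw, dotProduct_smul, hφu] at h
    simp [standardValue] at h
    apply mul_left_cancel₀ (mul_ne_zero h2 h2)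
    simp only [halfPolar]
    linear_combination -h
  -- The values `s = 1` and `s = √-1` separate the linear and cubic terms.
  obtain ⟨s, hs⟩ := IsAlgClosed.exists_pow_nat_eq (-1 : k) (n := 2) (by norm_num)
  have hs0 : s ≠ 0 := by rintro rfl; simp at hs
  have hpol : ∀ w, φ ⬝ᵥ w = 0 → halfPolar A B C a b c u w = 0 ∧ halfPolar A B C a b c w u = 0 := by
    intro w hw
    have e1 := heven w hw 1
    have e2 := (mul_eq_zero.mp (heven w hw s)).resolve_left hs0
    rw [hs] at e2
    constructor
    · apply mul_left_cancel₀ h2; linear_combination e1 + e2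
    · apply mul_left_cancel₀ h2; linear_combination e1 - e2
  -- `ψ` is half the gradient of the form at `u`; it turns out to be a nonzero multiple of `φ`.
  obtain ⟨ψ, hψ⟩ : ∃ ψ : Fin 3 → k, ψ = ![u 0 * (2 * A * u 0 ^ 2 + c * u 1 ^ 2 + b * u 2 ^ 2),
      u 1 * (c * u 0 ^ 2 + 2 * B * u 1 ^ 2 + a * u 2 ^ 2),
      u 2 * (b * u 0 ^ 2 + a * u 1 ^ 2 + 2 * C * u 2 ^ 2)] := ⟨_, rfl⟩
  have hψpol : ∀ w, ψ ⬝ᵥ w = halfPolar A B C a b c w u := by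
    intro w
    rw [Matrix.vec3_dotProduct]
    simp [hψ, halfPolar]; ring
  have hψw : ∀ w, (-2) * (ψ ⬝ᵥ w) = (φ ⬝ᵥ w) * (ψ ⬝ᵥ u) := by
    intro w
    -- As `φ(u) = -2`, the vector `-2w - φ(w)u` lies in the plane `φ = 0`.
    have h := (hpol ((-2 : k) • w - (φ ⬝ᵥ w) • u) (by
      rw [dotProduct_sub, dotProduct_smul, dotProduct_smul, hφu]; simp [mul_comm])).2
    rw [← hψpol, dotProduct_sub, dotProduct_smul, dotProduct_smul] at h
    simpa [sub_eq_zero] using h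
  have hψu : ψ ⬝ᵥ u ≠ 0 := by
    intro h
    have hz : ∀ w, ψ ⬝ᵥ w = 0 := by
      intro w
      have := hψw w
      rw [h, mul_zero] at this
      simpa [h2] using this
    have hψ0 : ψ = 0 := dotProduct_eq_zero_iff.mp hz
    apply hsm u hu0
    rw [hψ0] at hψ
    exact ⟨(congrFun hψ 0).symm, (congrFun hψ 1).symm, (congrFun hψ 2).symm⟩
  have hψφ : ∀ w, ψ ⬝ᵥ w = 0 → φ ⬝ᵥ w = 0 := by
    intro w hw
    have := hψw w
    rw [hw, mul_zero, eq_comm] at this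
    exact (mul_eq_zero.mp this).resolve_right hψu
  -- Each coordinate of the gradient is divisible by the matching coordinate of `u`. Hence a nonzero
  -- off-diagonal entry `φ j * u i` makes both `u i` and `u j` nonzero, and `u` is not a vertex.
  have hφi : ∀ i, u i = 0 → φ i = 0 := by
    intro i hi
    have := hψφ (Pi.single i 1) (by
      rw [dotProduct_single_one, hψ]
      fin_cases i <;> simp at hi ⊢ <;> simp [hi])
    simpa using this
  refine coeff_relation_of_polar h2 hA hB hC ha hb hc u ψ (by simp [hψ]) (by simp [hψ])
    (by simp [hψ]) ?_ (fun w hw => (hpol w (hψφ w ?_)).1) ?_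
  · rw [Matrix.vec3_dotProduct] at hψu
    convert hψu using 1; ring
  · rw [Matrix.vec3_dotProduct]; exact hw
  · have hij' : φ j * u i ≠ 0 := by
      rw [← hentry i j hij]
      rcases hNM with rfl | rfl
      · exact hMij
      · simpa using hMij
    have hui : u i ≠ 0 := right_ne_zero_of_mul hij'
    have huj : u j ≠ 0 := fun h => left_ne_zero_of_mul hij' (hφi j h)
    have key : ∀ i j : Fin 3, i ≠ j → u i ≠ 0 → u j ≠ 0 →
        ¬ (u 0 = 0 ∧ u 1 = 0) ∧ ¬ (u 0 = 0 ∧ u 2 = 0) ∧ ¬ (u 1 = 0 ∧ u 2 = 0) := by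
      clear * -
      intro i j
      fin_cases i <;> fin_cases j <;> simp +contextual
    exact key i j hij hui huj

end Involutions

/-! ### Differentials on a smooth affine plane curve -/

section PlaneCharts

open MvPolynomial

theorem derivation_aeval_two {k L M : Type*} [CommRing k] [CommRing L] [Algebra k L]
    [AddCommGroup M] [Module k M] [Module L M] (D : Derivation k L M) (x y : L)
    (g : MvPolynomial (Fin 2) k) :
    D (aeval ![x, y] g) =
      aeval ![x, y] (pderiv 0 g) • D x + aeval ![x, y] (pderiv 1 g) • D y := by
  induction g using MvPolynomial.induction_on with
  | C c => simp
  | add p q hp hq => simp only [map_add, hp, hq, add_smul]; abel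
  | mul_X p i hp =>
    rw [map_mul, Derivation.leibniz, hp]
    fin_cases i
    · simp [pderiv_X]
      module
    · simp [pderiv_X]
      module

theorem taylor_two {k : Type*} [CommRing k] (p : Fin 2 → k) (g : MvPolynomial (Fin 2) k) :
    ∃ r s : MvPolynomial (Fin 2) k,
      g = C (eval p g) + (X 0 - C (p 0)) * r + (X 1 - C (p 1)) * s := by
  induction g using MvPolynomial.induction_on with
  | C c => exact ⟨0, 0, by simp⟩
  | add g h hg hh =>
    obtain ⟨r, s, e⟩ := hg
    obtain ⟨r', s', e'⟩ := hh
    exact ⟨r + r', s + s', by rw [map_add, C_add]; linear_combination e + e'⟩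
  | mul_X g i hg =>
    obtain ⟨r, s, e⟩ := hg
    fin_cases i
    · refine ⟨r * C (p 0) + g, s * C (p 0), ?_⟩
      simp only [map_mul, eval_X, Fin.zero_eta]
      linear_combination C (p 0) * e
    · refine ⟨r * C (p 1), s * C (p 1) + g, ?_⟩
      simp only [map_mul, eval_X, Fin.mk_one]
      linear_combination C (p 1) * e

variable {k L : Type*} [Field k] [Field L] [Algebra k L]

/-- `L` is generated by `x` and `y`, which lie on the affine plane curve `f = 0` without singular
points, and `ω` is the differential `dx / f_y = - dy / f_x`. -/
structure IsSmoothChart (f : MvPolynomial (Fin 2) k) (x y : L) (ω : Ω[L⁄k]) : Prop where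
  generates : IntermediateField.adjoin k {x, y} = ⊤
  relation : aeval ![x, y] f = 0
  smooth : ∀ p : Fin 2 → k, eval p f = 0 → eval p (pderiv 0 f) ≠ 0 ∨ eval p (pderiv 1 f) ≠ 0
  d_fst : KaehlerDifferential.D k L x = aeval ![x, y] (pderiv 1 f) • ω
  d_snd : KaehlerDifferential.D k L y = -aeval ![x, y] (pderiv 0 f) • ω

/-- By the Nullstellensatz, as `f` and its two partial derivatives have no common zero. -/
theorem exists_bezout_of_smooth [IsAlgClosed k] {f : MvPolynomial (Fin 2) k}
    (smooth : ∀ p : Fin 2 → k, eval p f = 0 →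
      eval p (pderiv 0 f) ≠ 0 ∨ eval p (pderiv 1 f) ≠ 0) :
    ∃ α β γ, α * pderiv 0 f + β * pderiv 1 f + γ * f = 1 := by
  have h : Ideal.span {pderiv 0 f, pderiv 1 f, f} = ⊤ := by
    rw [← Ideal.radical_eq_top, ← vanishingIdeal_zeroLocus_eq_radical (K := k), zeroLocus_span]
    convert! vanishingIdeal_empty
    ext p
    simp only [Set.mem_insert_iff, Set.mem_singleton_iff, forall_eq_or_imp, forall_eq,
      Set.mem_ofPred_eq, Set.mem_empty_iff_false, iff_false, not_and, aeval_eq_eval]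
    intro h0 h1 h2
    exact (smooth p h2).elim (fun h => h h0) (fun h => h h1)
  have h1 : (1 : MvPolynomial (Fin 2) k) ∈ Ideal.span {pderiv 0 f, pderiv 1 f, f} := by
    rw [h]; trivial
  rw [Ideal.mem_span_insert] at h1
  obtain ⟨α, z, hz, e⟩ := h1
  rw [Ideal.mem_span_pair] at hz
  obtain ⟨β, γ, e'⟩ := hz
  exact ⟨α, β, γ, by rw [e, ← e']; ring⟩

theorem exists_isSmoothChart [IsAlgClosed k] {f : MvPolynomial (Fin 2) k} {x y : L}
    (generates : IntermediateField.adjoin k {x, y} = ⊤)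
    (relation : aeval ![x, y] f = 0)
    (smooth : ∀ p : Fin 2 → k, eval p f = 0 →
      eval p (pderiv 0 f) ≠ 0 ∨ eval p (pderiv 1 f) ≠ 0) :
    ∃ ω, IsSmoothChart f x y ω := by
  obtain ⟨α, β, γ, e⟩ := exists_bezout_of_smooth smooth
  have e' := congrArg (aeval ![x, y]) e
  simp only [map_add, map_mul, relation, mul_zero, add_zero, map_one] at e'
  have hd := derivation_aeval_two (KaehlerDifferential.D k L) x y f
  rw [relation, map_zero] at hd
  -- On the curve `α f_x + β f_y = 1` and `f_x dx + f_y dy = 0`, so `ω = β dx - α dy` is `dx / f_y`,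
  -- without any division.
  refine ⟨aeval ![x, y] β • KaehlerDifferential.D k L x -
    aeval ![x, y] α • KaehlerDifferential.D k L y, generates, relation, smooth, ?_, ?_⟩
  · have : aeval ![x, y] α •
        (aeval ![x, y] (pderiv 0 f) • KaehlerDifferential.D k L x +
          aeval ![x, y] (pderiv 1 f) • KaehlerDifferential.D k L y) = 0 := by rw [← hd, smul_zero]
    linear_combination (norm := module) (1 : L) • this + (-e') • KaehlerDifferential.D k L x
  · have : aeval ![x, y] β •
        (aeval ![x, y] (pderiv 0 f) • KaehlerDifferential.D k L x +
          aeval ![x, y] (pderiv 1 f) • KaehlerDifferential.D k L y) = 0 := by rw [← hd, smul_zero]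
    linear_combination (norm := module) (1 : L) • this + (-e') • KaehlerDifferential.D k L y

namespace IsSmoothChart

variable {f : MvPolynomial (Fin 2) k} {x y : L} {ω : Ω[L⁄k]}

theorem aeval_mem (O : Subring L) (hO : ∀ c : k, algebraMap k L c ∈ O) (hx : x ∈ O)
    (hy : y ∈ O) (g : MvPolynomial (Fin 2) k) : aeval ![x, y] g ∈ O := by
  induction g using MvPolynomial.induction_on with
  | C c => simpa using hO c
  | add p q hp hq => rw [map_add]; exact add_mem hp hq
  | mul_X p i hp =>
    rw [map_mul, aeval_X]
    refine mul_mem hp ?_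
    fin_cases i <;> simpa

theorem mem_span [IsAlgClosed k] (h : IsSmoothChart f x y ω) (O : ValuationSubring L)
    (hO : ∀ c : k, algebraMap k L c ∈ O) (hx : x ∈ O) (hy : y ∈ O) :
    ω ∈ Submodule.span O.toSubring (KaehlerDifferential.D k L '' (O : Set L)) := by
  obtain ⟨α, β, γ, e⟩ := exists_bezout_of_smooth h.smooth
  have e' := congrArg (aeval ![x, y]) e
  simp only [map_add, map_mul, h.relation, mul_zero, add_zero, map_one] at e'
  have hω : ω = aeval ![x, y] β • KaehlerDifferential.D k L x -
      aeval ![x, y] α • KaehlerDifferential.D k L y := by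
    rw [h.d_fst, h.d_snd]
    linear_combination (norm := module) (-e') • ω
  rw [hω]
  refine sub_mem ?_ ?_
  · exact Submodule.smul_mem _ (⟨_, aeval_mem O.toSubring hO hx hy β⟩ : O.toSubring)
      (Submodule.subset_span ⟨x, hx, rfl⟩)
  · exact Submodule.smul_mem _ (⟨_, aeval_mem O.toSubring hO hx hy α⟩ : O.toSubring)
      (Submodule.subset_span ⟨y, hy, rfl⟩)

theorem exists_d_eq (h : IsSmoothChart f x y ω) (g : MvPolynomial (Fin 2) k) :
    ∃ g' : MvPolynomial (Fin 2) k,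
      KaehlerDifferential.D k L (aeval ![x, y] g) = aeval ![x, y] g' • ω := by
  refine ⟨pderiv 0 g * pderiv 1 f - pderiv 1 g * pderiv 0 f, ?_⟩
  rw [derivation_aeval_two, h.d_fst, h.d_snd]
  simp only [map_sub, map_mul]
  module

theorem exists_smul_eq (h : IsSmoothChart f x y ω) (η : Ω[L⁄k]) : ∃ g : L, η = g • ω := by
  have hD : ∀ z : L, KaehlerDifferential.D k L z ∈ Submodule.span L {ω} := by
    intro z
    have hz : z ∈ IntermediateField.adjoin k {x, y} := by rw [h.generates]; trivial
    have hω := Submodule.mem_span_singleton_self (R := L) ω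
    induction hz using IntermediateField.adjoin_induction with
    | mem z hz =>
      rcases hz with rfl | rfl
      · rw [h.d_fst]; exact Submodule.smul_mem _ _ hω
      · rw [h.d_snd]; exact Submodule.smul_mem _ _ hω
    | algebraMap c => simp
    | add a b _ _ ha hb => rw [map_add]; exact add_mem ha hb
    | inv a _ ha => rw [Derivation.leibniz_inv]; exact Submodule.smul_mem _ _ ha
    | mul a b _ _ ha hb =>
      rw [Derivation.leibniz]
      exact add_mem (Submodule.smul_mem _ _ hb) (Submodule.smul_mem _ _ ha)
  have htop : (⊤ : Submodule L (Ω[L⁄k])) ≤ Submodule.span L {ω} := by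
    rw [← KaehlerDifferential.span_range_derivation, Submodule.span_le]
    rintro _ ⟨z, rfl⟩
    exact hD z
  obtain ⟨g, hg⟩ := Submodule.mem_span_singleton.mp (htop (Submodule.mem_top (x := η)))
  exact ⟨g, hg.symm⟩

/-- If `ω = 0` then all differentials vanish, and `L`, being finitely generated, would be separable
algebraic over `k`. -/
theorem ne_zero [IsAlgClosed k] (h : IsSmoothChart f x y ω) (hx : Transcendental k x) :
    ω ≠ 0 := by
  rintro rfl
  have hsub : Subsingleton (Ω[L⁄k]) := by
    refine ⟨fun η η' => ?_⟩
    obtain ⟨g, rfl⟩ := h.exists_smul_eq η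
    obtain ⟨g', rfl⟩ := h.exists_smul_eq η'
    simp
  have hur : Algebra.FormallyUnramified k L := ⟨hsub⟩
  have hfg : Algebra.EssFiniteType k L := by
    rw [← IntermediateField.fg_top_iff, ← h.generates]
    exact IntermediateField.fg_adjoin_of_finite (Set.toFinite _)
  have hsep := Algebra.FormallyUnramified.isSeparable k L
  exact hx (Algebra.IsAlgebraic.isAlgebraic x)


theorem mem_adjoin_iff (x y z : L) :
    z ∈ Algebra.adjoin k {x, y} ↔ ∃ g : MvPolynomial (Fin 2) k, aeval ![x, y] g = z := by
  rw [← AlgHom.mem_range, ← Algebra.adjoin_range_eq_range_aeval, Matrix.range_cons,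
    Matrix.range_cons, Matrix.range_empty, Set.union_empty, Set.singleton_union]

theorem aeval_mem_adjoin (x y : L) (g : MvPolynomial (Fin 2) k) :
    aeval ![x, y] g ∈ Algebra.adjoin k {x, y} := (mem_adjoin_iff x y _).mpr ⟨g, rfl⟩

theorem isFractionRing_adjoin {x y : L} (h : IntermediateField.adjoin k {x, y} = ⊤) :
    IsFractionRing (Algebra.adjoin k {x, y}) L := by
  refine IsFractionRing.of_field _ L fun z => ?_
  have hz : z ∈ IntermediateField.adjoin k {x, y} := by rw [h]; trivial
  obtain ⟨r, hr, s, hs, e⟩ := IntermediateField.mem_adjoin_iff_div.mp hz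
  exact ⟨⟨r, hr⟩, ⟨s, hs⟩, e⟩

theorem isNoetherianRing (x y : L) : IsNoetherianRing (Algebra.adjoin k {x, y}) :=
  isNoetherianRing_of_fg (Subalgebra.fg_def.2 ⟨_, Set.toFinite _, rfl⟩)

/-- The local ring of a smooth affine plane curve at a maximal ideal is a valuation ring. -/
theorem valuationRing_localization [IsAlgClosed k] (h : IsSmoothChart f x y ω)
    (A : Type*) [CommRing A] [IsDomain A] [Algebra (Algebra.adjoin k {x, y}) A]
    (m : Ideal (Algebra.adjoin k {x, y})) [hm : m.IsMaximal] [IsLocalization.AtPrime A m] :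
    ValuationRing A := by
  have : IsNoetherianRing (Algebra.adjoin k {x, y}) := isNoetherianRing x y
  have : IsNoetherianRing A := IsLocalization.isNoetherianRing m.primeCompl A inferInstance
  have : IsLocalRing A := IsLocalization.AtPrime.isLocalRing A m
  -- It suffices that the maximal ideal is principal.
  refine ((tfae_of_isNoetherianRing_of_isLocalRing_of_isDomain A).out 4 1).mp ?_
  let R := Algebra.adjoin k {x, y}
  let θ : MvPolynomial (Fin 2) k →ₐ[k] R :=
    (aeval ![x, y]).codRestrict R (aeval_mem_adjoin x y)
  have hθ : Function.Surjective θ := by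
    rintro ⟨z, hz⟩
    obtain ⟨g, hg⟩ := (mem_adjoin_iff x y z).mp hz
    exact ⟨g, Subtype.ext hg⟩
  have hm' : (m.comap θ).IsMaximal := Ideal.comap_isMaximal_of_surjective θ hθ
  obtain ⟨p, hp⟩ := isMaximal_iff_eq_vanishingIdeal_singleton.mp hm'
  have hmem : ∀ g, θ g ∈ m ↔ eval p g = 0 := by
    intro g
    rw [← Ideal.mem_comap, hp, mem_vanishingIdeal_singleton_iff, aeval_eq_eval]
  have hf : θ f = 0 := Subtype.ext h.relation
  have hfp : eval p f = 0 := by rw [← hmem, hf]; exact m.zero_mem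
  set ι := algebraMap R A with hι
  have hunit : ∀ g, eval p g ≠ 0 → IsUnit (ι (θ g)) := fun g hg =>
    IsLocalization.map_units A (⟨θ g, fun hc => hg ((hmem g).mp hc)⟩ : m.primeCompl)
  set s := ι (θ (X 0 - C (p 0))) with hs
  set t := ι (θ (X 1 - C (p 1))) with ht
  have hmax : IsLocalRing.maximalIdeal A = Ideal.span {s, t} := by
    rw [← IsLocalization.AtPrime.map_eq_maximalIdeal m A]
    apply le_antisymm
    · rw [Ideal.map_le_iff_le_comap]
      intro z hz
      obtain ⟨g, rfl⟩ := hθ z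
      obtain ⟨u, v, e⟩ := taylor_two p g
      rw [(hmem g).mp hz, C_0, zero_add] at e
      rw [Ideal.mem_comap, e, map_add, map_mul, map_mul, map_add, map_mul, map_mul]
      exact add_mem (Ideal.mul_mem_right _ _ (Ideal.subset_span (Or.inl rfl)))
        (Ideal.mul_mem_right _ _ (Ideal.subset_span (Or.inr rfl)))
    · rw [Ideal.span_le]
      rintro z (rfl | rfl)
      · exact Ideal.mem_map_of_mem _ ((hmem _).mpr (by simp))
      · exact Ideal.mem_map_of_mem _ ((hmem _).mpr (by simp))
  -- Expanding `f` at the point `p` gives `su + tv = 0` in the local ring, where `u` and `v` take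
  -- the values of the partial derivatives at `p`. One of them is a unit, so one of `s, t` is a
  -- multiple of the other.
  obtain ⟨u, v, e⟩ := taylor_two p f
  rw [hfp, C_0, zero_add] at e
  have e0 : eval p (pderiv 0 f) = eval p u := by
    rw [e]; simp [pderiv_X]
  have e1 : eval p (pderiv 1 f) = eval p v := by
    rw [e]; simp [pderiv_X]
  have hrel : s * ι (θ u) + t * ι (θ v) = 0 := by
    rw [hs, ht, ← map_mul, ← map_mul, ← map_mul, ← map_mul, ← map_add, ← map_add, ← e, hf, map_zero]
  rw [hmax]
  rcases h.smooth p hfp with h0 | h1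
  · rw [e0] at h0
    obtain ⟨w, hw⟩ := hunit u h0
    refine ⟨t, le_antisymm ?_ ?_⟩
    · rw [Ideal.span_le]
      rintro z (rfl | rfl)
      · refine Ideal.mem_span_singleton'.mpr ⟨-(ι (θ v)) * ↑w⁻¹, ?_⟩
        have : s = s * (w * ↑w⁻¹) := by simp
        rw [this, hw]
        linear_combination -(↑w⁻¹ : A) * hrel
      · exact Ideal.subset_span rfl
    · exact Ideal.span_mono (by simp)
  · rw [e1] at h1
    obtain ⟨w, hw⟩ := hunit v h1
    refine ⟨s, le_antisymm ?_ ?_⟩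
    · rw [Ideal.span_le]
      rintro z (rfl | rfl)
      · exact Ideal.subset_span rfl
      · refine Ideal.mem_span_singleton'.mpr ⟨-(ι (θ u)) * ↑w⁻¹, ?_⟩
        have : t = t * (w * ↑w⁻¹) := by simp
        rw [this, hw]
        linear_combination -(↑w⁻¹ : A) * hrel
    · exact Ideal.span_mono (by simp)

/-- If `g ω` is a regular differential then `g` is a regular function on the affine chart. -/
theorem mem_adjoin_of_smul_mem [IsAlgClosed k] (h : IsSmoothChart f x y ω) (hω : ω ≠ 0) {g : L}
    (hg : g • ω ∈ regularDifferentials k L) : g ∈ Algebra.adjoin k {x, y} := by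
  have := isFractionRing_adjoin h.generates
  -- The coordinate ring is the intersection of its localizations at maximal ideals, and each of
  -- these is a valuation ring containing `k`.
  suffices hloc : g ∈ (⨅ v : MaximalSpectrum (Algebra.adjoin k {x, y}),
      Localization.subalgebra.ofField L _ v.asIdeal.primeCompl_le_nonZeroDivisors) by
    rw [MaximalSpectrum.iInf_localization_eq_bot, Algebra.mem_bot] at hloc
    obtain ⟨z, rfl⟩ := hloc
    exact z.2
  rw [Algebra.mem_iInf]
  intro v
  have := v.isMaximal
  set A := Localization.subalgebra.ofField L _ v.asIdeal.primeCompl_le_nonZeroDivisors with hA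
  have : IsLocalization.AtPrime A v.asIdeal := Localization.subalgebra.isLocalization_ofField ..
  have hval : ValuationRing A := h.valuationRing_localization A v.asIdeal
  have hfrac : IsFractionRing A L := Localization.subalgebra.isFractionRing_ofField ..
  let O : ValuationSubring L :=
    { A.toSubring with
      mem_or_inv_mem' := by
        intro z
        rcases (ValuationRing.iff_isInteger_or_isInteger A L).mp hval z with ⟨w, hw⟩ | ⟨w, hw⟩
        · left; rw [← hw]; exact w.2
        · right; rw [← hw]; exact w.2 }
  have hO : ∀ z, z ∈ O ↔ z ∈ A := fun z => Iff.rfl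
  have hmem : ∀ z : Algebra.adjoin k {x, y}, (z : L) ∈ O := fun z => A.algebraMap_mem z
  have hreg := hg O fun c => hmem (algebraMap k _ c)
  -- By the quotient rule, `dz` is an `O`-multiple of `ω` for every `z` in `O`.
  have hle : Submodule.span O.toSubring (KaehlerDifferential.D k L '' (O : Set L)) ≤
      Submodule.span O.toSubring {ω} := by
    rw [Submodule.span_le]
    rintro _ ⟨z, hz, rfl⟩
    obtain ⟨r, s, hs, rfl⟩ := (hO z).mp hz
    obtain ⟨G, hG⟩ := (mem_adjoin_iff x y r).mp r.2
    obtain ⟨H, hH⟩ := (mem_adjoin_iff x y s).mp s.2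
    obtain ⟨G', hG'⟩ := h.exists_d_eq G
    obtain ⟨H', hH'⟩ := h.exists_d_eq H
    have hsinv : (s : L)⁻¹ ∈ O := (hO _).mpr ⟨1, s, hs, by simp⟩
    have hcoef : (s : L)⁻¹ ^ 2 * (s * aeval ![x, y] G' - r * aeval ![x, y] H') ∈ O :=
      mul_mem (pow_mem hsinv 2) (sub_mem (mul_mem (hmem s) (hmem ⟨_, aeval_mem_adjoin x y G'⟩))
        (mul_mem (hmem r) (hmem ⟨_, aeval_mem_adjoin x y H'⟩)))
    rw [SetLike.mem_coe, Submodule.mem_span_singleton]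
    refine ⟨⟨_, hcoef⟩, ?_⟩
    change ((s : L)⁻¹ ^ 2 * (s * aeval ![x, y] G' - r * aeval ![x, y] H')) • ω =
      KaehlerDifferential.D k L ((r : L) * (s : L)⁻¹)
    rw [← div_eq_mul_inv, Derivation.leibniz_div, ← hG, ← hH, hG', hH']
    module
  obtain ⟨o, ho⟩ := Submodule.mem_span_singleton.mp (hle hreg)
  have ho' : (o : L) • ω = g • ω := ho
  have : g = o := by
    have : (g - o) • ω = 0 := by rw [sub_smul, ho', sub_self]
    exact sub_eq_zero.mp ((smul_eq_zero.mp this).resolve_right hω)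
  rw [this]
  exact o.2

end IsSmoothChart
end PlaneCharts

/-! ### Transport of regular differentials along isomorphisms -/

section Transport

variable {k : Type*} [Field k]

/-- An isomorphism of fields over `k` acts semilinearly on differentials. -/
theorem exists_semilinear_map {L L' : Type*} [Field L] [Field L'] [Algebra k L] [Algebra k L']
    (e : L ≃ₐ[k] L') :
    ∃ φ : Ω[L⁄k] →+ Ω[L'⁄k], (∀ (z : L) (η : Ω[L⁄k]), φ (z • η) = e z • φ η) ∧
      ∀ z, φ (KaehlerDifferential.D k L z) = KaehlerDifferential.D k L' (e z) := by
  let _ : Algebra L L' := e.toAlgHom.toRingHom.toAlgebra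
  have : IsScalarTower k L L' := IsScalarTower.of_algebraMap_eq fun c => (e.commutes c).symm
  refine ⟨(KaehlerDifferential.map k k L L').toAddMonoidHom, fun z η => ?_, fun z => ?_⟩
  · change KaehlerDifferential.map k k L L' (z • η) = _
    rw [map_smul, ← algebraMap_smul L' z]
    rfl
  · exact KaehlerDifferential.map_D k k L L' z

theorem eq_id_of_semilinear {L : Type*} [Field L] [Algebra k L] (φ : Ω[L⁄k] →+ Ω[L⁄k])
    (h : ∀ (z : L) (η : Ω[L⁄k]), φ (z • η) = z • φ η)
    (hD : ∀ z, φ (KaehlerDifferential.D k L z) = KaehlerDifferential.D k L z) (η : Ω[L⁄k]) :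
    φ η = η := by
  have hη : η ∈ Submodule.span L (Set.range (KaehlerDifferential.D k L)) := by
    rw [KaehlerDifferential.span_range_derivation]; trivial
  induction hη using Submodule.span_induction with
  | mem η hη => obtain ⟨z, rfl⟩ := hη; exact hD z
  | zero => simp
  | add η η' _ _ h1 h2 => rw [map_add, h1, h2]
  | smul z η _ h1 => rw [h, h1]

theorem map_mem_regularDifferentials {L L' : Type*} [Field L] [Field L'] [Algebra k L]
    [Algebra k L'] (e : L ≃ₐ[k] L') (φ : Ω[L⁄k] →+ Ω[L'⁄k])
    (h : ∀ (z : L) (η : Ω[L⁄k]), φ (z • η) = e z • φ η)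
    (hD : ∀ z, φ (KaehlerDifferential.D k L z) = KaehlerDifferential.D k L' (e z))
    {η : Ω[L⁄k]} (hη : η ∈ regularDifferentials k L) : φ η ∈ regularDifferentials k L' := by
  intro O hO
  -- Regularity at `O` comes from regularity at the preimage of `O` under `e`.
  have hmem := hη (O.comap e.toAlgHom.toRingHom) fun c => by
    change e (algebraMap k L c) ∈ O
    rw [e.commutes]; exact hO c
  clear hη
  induction hmem using Submodule.span_induction with
  | mem η hη =>
    obtain ⟨z, hz, rfl⟩ := hη
    rw [hD]
    exact Submodule.subset_span ⟨e z, hz, rfl⟩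
  | zero => rw [map_zero]; exact zero_mem _
  | add η η' _ _ h1 h2 => rw [map_add]; exact add_mem h1 h2
  | smul z η _ h1 =>
    have : φ (z • η) = (⟨e z, z.2⟩ : O.toSubring) • φ η := h z η
    rw [this]
    exact Submodule.smul_mem _ _ h1

theorem genus_eq_zero_iff {L : Type*} [Field L] [Algebra k L] :
    genus k L = 0 ↔ ∀ η ∈ regularDifferentials k L, η = 0 := by
  rw [genus, rank_zero_iff, Submodule.subsingleton_iff_eq_bot, Submodule.eq_bot_iff]

theorem genus_eq_zero_of_algEquiv {L L' : Type*} [Field L] [Field L'] [Algebra k L]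
    [Algebra k L'] (e : L ≃ₐ[k] L') (h : genus k L = 0) : genus k L' = 0 := by
  rw [genus_eq_zero_iff] at h ⊢
  intro η hη
  obtain ⟨φ, hφ, hφD⟩ := exists_semilinear_map e
  obtain ⟨ψ, hψ, hψD⟩ := exists_semilinear_map e.symm
  have hid := eq_id_of_semilinear (φ.comp ψ) (fun z η => by simp [hφ, hψ])
    (fun z => by simp [hφD, hψD]) η
  rw [← hid, AddMonoidHom.comp_apply, h _ (map_mem_regularDifferentials e.symm ψ hψ hψD hη),
    map_zero]

end Transport

/-! ### Nonsingular standard forms -/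

section StandardForm

open MvPolynomial

variable {k : Type*} [Field k]

/-- The coefficients of a smooth standard form: half the gradient vanishes only at the origin. -/
def IsNonsingular (A B C a b c : k) : Prop :=
  ∀ u : Fin 3 → k, u ≠ 0 →
    ¬ (u 0 * (2 * A * u 0 ^ 2 + c * u 1 ^ 2 + b * u 2 ^ 2) = 0 ∧
      u 1 * (c * u 0 ^ 2 + 2 * B * u 1 ^ 2 + a * u 2 ^ 2) = 0 ∧
      u 2 * (b * u 0 ^ 2 + a * u 1 ^ 2 + 2 * C * u 2 ^ 2) = 0)

theorem SmoothQuartic.isNonsingular (h2 : (2 : k) ≠ 0) (Y : SmoothQuartic k) {A B C a b c : k}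
    (hY : Y.form = standardForm A B C a b c) : IsNonsingular A B C a b c := by
  rintro u hu ⟨h0, h1, h3⟩
  have hF : eval u Y.form = 0 := by
    rw [hY]
    simp only [standardForm, map_add, map_mul, map_pow, eval_C, eval_X]
    apply mul_left_cancel₀ h2
    linear_combination u 0 * h0 + u 1 * h1 + u 2 * h3
  obtain ⟨i, hi⟩ := Y.smooth u hu hF
  apply hi
  rw [hY]
  fin_cases i
  · simp [standardForm, pderiv_X]
    linear_combination 2 * h0
  · simp [standardForm, pderiv_X]
    linear_combination 2 * h1
  · simp [standardForm, pderiv_X]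
    linear_combination 2 * h3

namespace IsNonsingular

variable {A B C a b c : k}

theorem rotate (h : IsNonsingular A B C a b c) : IsNonsingular B C A b c a := by
  rintro u hu ⟨h0, h1, h3⟩
  refine h ![u 2, u 0, u 1] (fun hc => hu ?_) ⟨?_, ?_, ?_⟩
  · have e0 := congrFun hc 0
    have e1 := congrFun hc 1
    have e2 := congrFun hc 2
    simp at e0 e1 e2
    ext i; fin_cases i <;> simpa
  · change u 2 * (2 * A * u 2 ^ 2 + c * u 0 ^ 2 + b * u 1 ^ 2) = 0
    linear_combination h3
  · change u 0 * (c * u 2 ^ 2 + 2 * B * u 0 ^ 2 + a * u 1 ^ 2) = 0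
    linear_combination h0
  · change u 1 * (b * u 2 ^ 2 + a * u 0 ^ 2 + 2 * C * u 1 ^ 2) = 0
    linear_combination h1

theorem swap (h : IsNonsingular A B C a b c) : IsNonsingular C B A c b a := by
  rintro u hu ⟨h0, h1, h3⟩
  refine h ![u 2, u 1, u 0] (fun hc => hu ?_) ⟨?_, ?_, ?_⟩
  · have e0 := congrFun hc 0
    have e1 := congrFun hc 1
    have e2 := congrFun hc 2
    simp at e0 e1 e2
    ext i; fin_cases i <;> simpa
  · change u 2 * (2 * A * u 2 ^ 2 + c * u 1 ^ 2 + b * u 0 ^ 2) = 0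
    linear_combination h3
  · change u 1 * (c * u 2 ^ 2 + 2 * B * u 1 ^ 2 + a * u 0 ^ 2) = 0
    linear_combination h1
  · change u 0 * (b * u 2 ^ 2 + a * u 1 ^ 2 + 2 * C * u 0 ^ 2) = 0
    linear_combination h0

theorem fst_ne_zero (h : IsNonsingular A B C a b c) : A ≠ 0 := by
  rintro rfl
  exact h ![1, 0, 0] (fun hc => one_ne_zero (congrFun hc 0)) (by simp)

theorem snd_ne_zero (h : IsNonsingular A B C a b c) : B ≠ 0 := h.rotate.fst_ne_zero

theorem trd_ne_zero (h : IsNonsingular A B C a b c) : C ≠ 0 := h.rotate.rotate.fst_ne_zero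

theorem sq_snd_ne [IsAlgClosed k] (h2 : (2 : k) ≠ 0) (h : IsNonsingular A B C a b c) :
    b ^ 2 ≠ 4 * A * C := by
  intro hb
  have hA := h.fst_ne_zero
  -- If `b² = 4AC`, then `(r : 0 : 1)` is singular, with `r²` the double root of `AT² + bT + C`.
  obtain ⟨r, hr⟩ := IsAlgClosed.exists_pow_nat_eq (-b / (2 * A)) (n := 2) (by norm_num)
  rw [eq_div_iff (mul_ne_zero h2 hA)] at hr
  refine h ![r, 0, 1] (fun hc => one_ne_zero (congrFun hc 2)) ⟨?_, ?_, ?_⟩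
  · simp; right; linear_combination hr
  · simp
  · simp
    apply mul_left_cancel₀ (mul_ne_zero h2 hA)
    linear_combination b * hr - hb

theorem sq_trd_ne [IsAlgClosed k] (h2 : (2 : k) ≠ 0) (h : IsNonsingular A B C a b c) :
    c ^ 2 ≠ 4 * A * B := by
  have := h.rotate.sq_snd_ne h2
  rwa [mul_right_comm] at this

theorem sq_fst_ne [IsAlgClosed k] (h2 : (2 : k) ≠ 0) (h : IsNonsingular A B C a b c) :
    a ^ 2 ≠ 4 * B * C := by
  have := h.rotate.rotate.sq_snd_ne h2
  rwa [mul_right_comm] at this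

end IsNonsingular

theorem dehomogenize_standardForm (A B C a b c : k) :
    dehomogenize (standardForm A B C a b c) =
      MvPolynomial.C A * X 0 ^ 4 + MvPolynomial.C B * X 1 ^ 4 + MvPolynomial.C C +
        MvPolynomial.C a * X 1 ^ 2 + MvPolynomial.C b * X 0 ^ 2 +
        MvPolynomial.C c * X 0 ^ 2 * X 1 ^ 2 := by
  simp [dehomogenize, standardForm, algebraMap_eq]

theorem IsNonsingular.dehomogenize_smooth {A B C a b c : k} (h2 : (2 : k) ≠ 0)
    (h : IsNonsingular A B C a b c) (p : Fin 2 → k)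
    (hp : eval p (dehomogenize (standardForm A B C a b c)) = 0) :
    eval p (pderiv 0 (dehomogenize (standardForm A B C a b c))) ≠ 0 ∨
      eval p (pderiv 1 (dehomogenize (standardForm A B C a b c))) ≠ 0 := by
  by_contra! hc
  obtain ⟨h0, h1⟩ := hc
  rw [dehomogenize_standardForm] at hp h0 h1
  simp [pderiv_X] at hp h0 h1
  have e0 : p 0 * (2 * A * p 0 ^ 2 + c * p 1 ^ 2 + b) = 0 := by
    apply mul_left_cancel₀ h2; linear_combination h0
  have e1 : p 1 * (c * p 0 ^ 2 + 2 * B * p 1 ^ 2 + a) = 0 := by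
    apply mul_left_cancel₀ h2; linear_combination h1
  refine h ![p 0, p 1, 1] (fun hc => one_ne_zero (congrFun hc 2)) ⟨?_, ?_, ?_⟩
  · change p 0 * (2 * A * p 0 ^ 2 + c * p 1 ^ 2 + b * 1 ^ 2) = 0
    linear_combination e0
  · change p 1 * (c * p 0 ^ 2 + 2 * B * p 1 ^ 2 + a * 1 ^ 2) = 0
    linear_combination e1
  · change 1 * (b * p 0 ^ 2 + a * p 1 ^ 2 + 2 * C * 1 ^ 2) = 0
    -- Euler's relation recovers the third partial derivative.
    linear_combination 2 * hp - p 0 * e0 - p 1 * e1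

end StandardForm

/-! ### Independence relations in the function field -/

section StandardFunctionField

open MvPolynomial

variable {k L : Type*} [Field k] [Field L] [Algebra k L] {A B C a b c : k} {x y : L}

local notation "κ" => algebraMap k L

theorem aeval_dehomogenize_standardForm (A B C a b c : k) (x y : L) :
    aeval ![x, y] (dehomogenize (standardForm A B C a b c)) =
      κ A * x ^ 4 + κ B * y ^ 4 + κ C + κ a * y ^ 2 + κ b * x ^ 2 + κ c * x ^ 2 * y ^ 2 := by
  simp [dehomogenize_standardForm]

theorem IsFunctionField.equation (h : IsFunctionField (standardForm A B C a b c) x y) :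
    κ A * x ^ 4 + κ B * y ^ 4 + κ C + κ a * y ^ 2 + κ b * x ^ 2 + κ c * x ^ 2 * y ^ 2 = 0 := by
  rw [← aeval_dehomogenize_standardForm, h.relations]

/-- The powers `1, y, y², y³` are linearly independent over `k[x]`. -/
theorem IsFunctionField.eq_zero_of_combination
    (h : IsFunctionField (standardForm A B C a b c) x y) (hB : B ≠ 0)
    {p₀ p₁ p₂ p₃ : Polynomial k}
    (hp : Polynomial.aeval x p₀ + Polynomial.aeval x p₁ * y + Polynomial.aeval x p₂ * y ^ 2 +
      Polynomial.aeval x p₃ * y ^ 3 = 0) : p₀ = 0 ∧ p₁ = 0 ∧ p₂ = 0 ∧ p₃ = 0 := by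
  let ι : Polynomial k →ₐ[k] MvPolynomial (Fin 2) k := Polynomial.aeval (X 0)
  -- `ψ` reads a polynomial in two variables as a polynomial in `y` over `k[x]`. There the equation
  -- of the curve has degree 4 with constant leading coefficient `B`, so it divides no nonzero
  -- polynomial of degree at most 3.
  let ψ : MvPolynomial (Fin 2) k →ₐ[k] Polynomial (Polynomial k) :=
    aeval ![Polynomial.C Polynomial.X, Polynomial.X]
  have hι : ∀ p, aeval ![x, y] (ι p) = Polynomial.aeval x p := fun p => by
    rw [← Polynomial.aeval_algHom_apply]; simp
  have hψ : ∀ p, ψ (ι p) = Polynomial.C p := fun p => by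
    have : ψ.comp ι = Polynomial.CAlgHom := by ext; simp [ψ, ι]
    exact DFunLike.congr_fun this p
  have hdvd : dehomogenize (standardForm A B C a b c) ∣
      ι p₀ + ι p₁ * X 1 + ι p₂ * X 1 ^ 2 + ι p₃ * X 1 ^ 3 := by
    rw [← h.relations]
    simpa [hι] using hp
  have hdvd' := map_dvd ψ hdvd
  have hf : ψ (dehomogenize (standardForm A B C a b c)) =
      Polynomial.C (Polynomial.C B) * Polynomial.X ^ 4 +
        Polynomial.C (Polynomial.C a + Polynomial.C c * Polynomial.X ^ 2) * Polynomial.X ^ 2 +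
        Polynomial.C (Polynomial.C A * Polynomial.X ^ 4 + Polynomial.C C +
          Polynomial.C b * Polynomial.X ^ 2) := by
    simp [dehomogenize_standardForm, ψ]
    ring
  have hG : ψ (ι p₀ + ι p₁ * X 1 + ι p₂ * X 1 ^ 2 + ι p₃ * X 1 ^ 3) =
      Polynomial.C p₃ * Polynomial.X ^ 3 + Polynomial.C p₂ * Polynomial.X ^ 2 +
        Polynomial.C p₁ * Polynomial.X + Polynomial.C p₀ := by
    simp only [map_add, map_mul, map_pow, hψ]
    simp [ψ]
    ring
  rw [hf, hG] at hdvd'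
  have hzero := Polynomial.eq_zero_of_dvd_of_natDegree_lt hdvd' (by
    refine lt_of_le_of_lt Polynomial.natDegree_cubic_le (lt_of_lt_of_le (by norm_num : 3 < 4) ?_)
    have key : ∀ q r : Polynomial k, 4 ≤ (Polynomial.C (Polynomial.C B) * Polynomial.X ^ 4 +
        Polynomial.C q * Polynomial.X ^ 2 + Polynomial.C r).natDegree := fun q r => by
      refine Polynomial.le_natDegree_of_ne_zero ?_
      rw [Polynomial.coeff_add, Polynomial.coeff_add, Polynomial.coeff_C_mul_X_pow,
        Polynomial.coeff_C_mul_X_pow, Polynomial.coeff_C]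
      simpa using hB
    exact key _ _)
  refine ⟨?_, ?_, ?_, ?_⟩
  · simpa [Polynomial.coeff_X, Polynomial.coeff_C] using congrArg (Polynomial.coeff · 0) hzero
  · simpa [Polynomial.coeff_X, Polynomial.coeff_C] using congrArg (Polynomial.coeff · 1) hzero
  · simpa [Polynomial.coeff_X, Polynomial.coeff_C] using congrArg (Polynomial.coeff · 2) hzero
  · simpa [Polynomial.coeff_X, Polynomial.coeff_C] using congrArg (Polynomial.coeff · 3) hzero

theorem IsFunctionField.transcendental (h : IsFunctionField (standardForm A B C a b c) x y)
    (hB : B ≠ 0) : Transcendental k x := by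
  rw [transcendental_iff]
  intro p hp
  exact (h.eq_zero_of_combination hB (p₀ := p) (p₁ := 0) (p₂ := 0) (p₃ := 0) (by simp [hp])).1

theorem IsFunctionField.linear_independent (h : IsFunctionField (standardForm A B C a b c) x y)
    (hB : B ≠ 0) {α β γ : k} (e : κ α * x + κ β * y + κ γ = 0) : α = 0 ∧ β = 0 ∧ γ = 0 := by
  obtain ⟨h0, h1, -, -⟩ := h.eq_zero_of_combination hB
    (p₀ := Polynomial.C α * Polynomial.X + Polynomial.C γ) (p₁ := Polynomial.C β) (p₂ := 0)
    (p₃ := 0) (by simp; linear_combination e)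
  refine ⟨?_, ?_, ?_⟩
  · simpa [Polynomial.coeff_X, Polynomial.coeff_C] using congrArg (Polynomial.coeff · 1) h0
  · simpa using h1
  · simpa [Polynomial.coeff_X, Polynomial.coeff_C] using congrArg (Polynomial.coeff · 0) h0

theorem IsFunctionField.fst_ne_zero (h : IsFunctionField (standardForm A B C a b c) x y)
    (hB : B ≠ 0) : x ≠ 0 := by
  rintro rfl
  exact one_ne_zero (h.linear_independent hB (α := 1) (β := 0) (γ := 0) (by simp)).1

end StandardFunctionField

/-! ### The regular differentials of a standard quartic -/

section RegularDifferentials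

open MvPolynomial

variable {k L : Type*} [Field k] [Field L] [Algebra k L] {A B C a b c : k} {x y : L}

local notation "κ" => algebraMap k L

theorem adjoin_inv_div_eq_top {x y : L} (hx : x ≠ 0)
    (h : IntermediateField.adjoin k {x, y} = ⊤) :
    IntermediateField.adjoin k {x⁻¹, y / x} = ⊤ := by
  rw [eq_top_iff, ← h, IntermediateField.adjoin_le_iff]
  have h1 : x⁻¹ ∈ IntermediateField.adjoin k {x⁻¹, y / x} :=
    IntermediateField.subset_adjoin _ _ (by simp)
  have h2 : y / x ∈ IntermediateField.adjoin k {x⁻¹, y / x} :=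
    IntermediateField.subset_adjoin _ _ (by simp)
  rintro z (rfl | rfl)
  · simpa using inv_mem h1
  · have := div_mem h2 h1
    rwa [div_inv_eq_mul, div_mul_cancel₀ _ hx] at this

/-- The chart at `x = ∞` of a smooth standard quartic. -/
theorem IsSmoothChart.inv [IsAlgClosed k] (h2 : (2 : k) ≠ 0) (hns : IsNonsingular A B C a b c)
    (hx : x ≠ 0) {ω : Ω[L⁄k]}
    (h : IsSmoothChart (dehomogenize (standardForm A B C a b c)) x y ω) :
    IsSmoothChart (dehomogenize (standardForm C B A c b a)) x⁻¹ (y / x) (-(x • ω)) := by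
  have hrel := h.relation
  rw [aeval_dehomogenize_standardForm] at hrel
  have hdx := h.d_fst
  have hdy := h.d_snd
  rw [dehomogenize_standardForm] at hdx hdy
  simp [pderiv_X] at hdx hdy
  refine ⟨adjoin_inv_div_eq_top hx h.generates, ?_, hns.swap.dehomogenize_smooth h2, ?_, ?_⟩
  · rw [aeval_dehomogenize_standardForm]
    field_simp
    linear_combination hrel
  · rw [dehomogenize_standardForm, Derivation.leibniz_inv, hdx]
    simp [pderiv_X, smul_smul, ← neg_smul]
    congr 1
    field_simp
    ring
  · rw [dehomogenize_standardForm, Derivation.leibniz_div, hdx, hdy]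
    simp only [map_add, Derivation.leibniz, Derivation.leibniz_pow, pderiv_C, pderiv_X]
    simp
    rw [smul_smul, smul_smul, smul_smul, ← sub_smul, smul_smul, ← neg_smul]
    congr 1
    field_simp
    linear_combination -4 * hrel

/-- `y` is integral over `k[x]`. Explicitly, if `y⁻¹` is in `O`, dividing the equation by `y³`
expresses `y` through `x` and `y⁻¹`. -/
theorem snd_mem_of_fst_mem (hB : B ≠ 0)
    (h : κ A * x ^ 4 + κ B * y ^ 4 + κ C + κ a * y ^ 2 + κ b * x ^ 2 + κ c * x ^ 2 * y ^ 2 = 0)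
    (O : ValuationSubring L) (hO : ∀ c : k, κ c ∈ O) (hx : x ∈ O) : y ∈ O := by
  rcases O.mem_or_inv_mem y with hy | hy
  · exact hy
  by_cases hy0 : y = 0
  · rw [hy0]; exact zero_mem _
  have hB' : κ B ≠ 0 := by simpa using hB
  have e : y = -(κ B⁻¹) * (κ A * x ^ 4 * y⁻¹ ^ 3 + κ C * y⁻¹ ^ 3 + κ a * y⁻¹ +
      κ b * x ^ 2 * y⁻¹ ^ 3 + κ c * x ^ 2 * y⁻¹) := by
    rw [map_inv₀]
    field_simp
    linear_combination h
  rw [e]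
  have := hO A
  have := hO C
  have := hO a
  have := hO b
  have := hO c
  refine mul_mem (neg_mem (hO _)) (add_mem (add_mem (add_mem (add_mem ?_ ?_) ?_) ?_) ?_)
  all_goals
    repeat' first | assumption | apply mul_mem | apply pow_mem

theorem exists_combination_of_mem_adjoin (hB : B ≠ 0)
    (h : κ A * x ^ 4 + κ B * y ^ 4 + κ C + κ a * y ^ 2 + κ b * x ^ 2 + κ c * x ^ 2 * y ^ 2 = 0)
    {z : L} (hz : z ∈ Algebra.adjoin k {x, y}) :
    ∃ p₀ p₁ p₂ p₃ : Polynomial k, z = Polynomial.aeval x p₀ + Polynomial.aeval x p₁ * y +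
      Polynomial.aeval x p₂ * y ^ 2 + Polynomial.aeval x p₃ * y ^ 3 := by
  obtain ⟨g, rfl⟩ := (IsSmoothChart.mem_adjoin_iff x y z).mp hz
  clear hz
  have hB' : κ B ≠ 0 := by simpa using hB
  induction g using MvPolynomial.induction_on with
  | C r => exact ⟨Polynomial.C r, 0, 0, 0, by simp⟩
  | add p q hp hq =>
    obtain ⟨p₀, p₁, p₂, p₃, hp⟩ := hp
    obtain ⟨q₀, q₁, q₂, q₃, hq⟩ := hq
    exact ⟨p₀ + q₀, p₁ + q₁, p₂ + q₂, p₃ + q₃, by simp only [map_add, hp, hq]; ring⟩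
  | mul_X p i hp =>
    obtain ⟨p₀, p₁, p₂, p₃, hp⟩ := hp
    fin_cases i
    · exact ⟨p₀ * Polynomial.X, p₁ * Polynomial.X, p₂ * Polynomial.X, p₃ * Polynomial.X, by
        simp [hp]; ring⟩
    · refine ⟨-(Polynomial.C B⁻¹) * p₃ * (Polynomial.C A * Polynomial.X ^ 4 + Polynomial.C C +
        Polynomial.C b * Polynomial.X ^ 2), p₀,
        p₁ - (Polynomial.C B⁻¹) * p₃ * (Polynomial.C a + Polynomial.C c * Polynomial.X ^ 2), p₂, ?_⟩
      simp [hp]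
      field_simp
      linear_combination Polynomial.aeval x p₃ * h

theorem exists_aeval_inv_mul_pow {x : L} (hx : x ≠ 0) (q : Polynomial k) {N : ℕ}
    (hN : q.natDegree ≤ N) :
    ∃ r : Polynomial k, r.natDegree ≤ N ∧
      Polynomial.aeval x⁻¹ q * x ^ N = Polynomial.aeval x r := by
  refine ⟨q.reflect N, Polynomial.natDegree_reflect_le.trans (by simp [hN]), ?_⟩
  let _ := invertibleOfNonzero hx
  have := Polynomial.eval₂_reflect_mul_pow κ x N (q.reflect N)
    (Polynomial.natDegree_reflect_le.trans (by simp [hN]))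
  rw [invOf_eq_inv, show (q.reflect N).reflect N = q by ext; simp] at this
  exact this

/-- The regular differentials of a smooth standard quartic are the multiples `g ω` with `g` a linear
combination of `1, x, y`. -/
theorem exists_linear_of_smul_mem_regularDifferentials [IsAlgClosed k] (h2 : (2 : k) ≠ 0)
    (hns : IsNonsingular A B C a b c) (hf : IsFunctionField (standardForm A B C a b c) x y)
    {ω : Ω[L⁄k]} (h : IsSmoothChart (dehomogenize (standardForm A B C a b c)) x y ω) {g : L}
    (hg : g • ω ∈ regularDifferentials k L) :
    ∃ α β γ : k, g = κ α * x + κ β * y + κ γ := by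
  have hB := hns.snd_ne_zero
  have hx := hf.fst_ne_zero hB
  have hω := h.ne_zero (hf.transcendental hB)
  have h' := h.inv h2 hns hx
  have hω' : -(x • ω) ≠ 0 := by simp [hx, hω]
  obtain ⟨p₀, p₁, p₂, p₃, hp⟩ := exists_combination_of_mem_adjoin hB hf.equation
    (h.mem_adjoin_of_smul_mem hω hg)
  have hrel' := h'.relation
  rw [aeval_dehomogenize_standardForm] at hrel'
  -- The same differential in the chart at infinity, where it is again regular.
  have hg' : (-(g / x)) • (-(x • ω)) ∈ regularDifferentials k L := by
    convert hg using 1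
    rw [neg_smul, smul_neg, neg_neg, smul_smul, div_mul_cancel₀ _ hx]
  obtain ⟨q₀, q₁, q₂, q₃, hq⟩ := exists_combination_of_mem_adjoin hB hrel'
    (h'.mem_adjoin_of_smul_mem hω' hg')
  obtain ⟨N, hN⟩ : ∃ N, N = max (max q₀.natDegree q₁.natDegree) (max q₂.natDegree q₃.natDegree) :=
    ⟨_, rfl⟩
  obtain ⟨r₀, hr₀, e₀⟩ := exists_aeval_inv_mul_pow hx q₀ (N := N) (by simp [hN])
  obtain ⟨r₁, hr₁, e₁⟩ := exists_aeval_inv_mul_pow hx q₁ (N := N) (by simp [hN])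
  obtain ⟨r₂, hr₂, e₂⟩ := exists_aeval_inv_mul_pow hx q₂ (N := N) (by simp [hN])
  obtain ⟨r₃, hr₃, e₃⟩ := exists_aeval_inv_mul_pow hx q₃ (N := N) (by simp [hN])
  -- The two expansions of `g` are compared after multiplication by `x ^ (N + 2)`: the term
  -- `q_i(1/x) (y/x)^i` acquires the factor `x ^ (N + 3)` and becomes `r_i x^(3-i) y^i` with `deg
  -- r_i ≤ N`. Hence `p_i = 0` or `deg p_i ≤ 1 - i`.
  obtain ⟨f₀, f₁, f₂, f₃⟩ := hf.eq_zero_of_combination hB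
    (p₀ := p₀ * Polynomial.X ^ (N + 2) + r₀ * Polynomial.X ^ 3)
    (p₁ := p₁ * Polynomial.X ^ (N + 2) + r₁ * Polynomial.X ^ 2)
    (p₂ := p₂ * Polynomial.X ^ (N + 2) + r₂ * Polynomial.X)
    (p₃ := p₃ * Polynomial.X ^ (N + 2) + r₃) (by
      simp only [map_add, map_mul, map_pow, Polynomial.aeval_X, ← e₀, ← e₁, ← e₂, ← e₃]
      have : g * x ^ (N + 2) + -(g / x) * x ^ (N + 3) = 0 := by field_simp; ring
      rw [hq, hp] at this
      rw [← this]
      field_simp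
      ring)
  have hdeg : ∀ {p r : Polynomial k} {i : ℕ}, r.natDegree ≤ N →
      p * Polynomial.X ^ (N + 2) + r * Polynomial.X ^ i = 0 → p = 0 ∨ p.natDegree + 2 ≤ i := by
    intro p r i hr e
    by_cases hp0 : p = 0
    · exact Or.inl hp0
    right
    have h1 := congrArg Polynomial.natDegree (eq_neg_of_add_eq_zero_left e)
    rw [Polynomial.natDegree_mul_X_pow _ hp0, Polynomial.natDegree_neg] at h1
    have h3 := Polynomial.natDegree_mul_le (p := r) (q := (Polynomial.X : Polynomial k) ^ i)
    rw [Polynomial.natDegree_X_pow] at h3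
    omega
  have g₃ : p₃ = 0 := (hdeg (i := 0) hr₃ (by simpa using f₃)).resolve_right (by omega)
  have g₂ : p₂ = 0 := (hdeg (i := 1) hr₂ (by simpa using f₂)).resolve_right (by omega)
  have g₁ : p₁.natDegree = 0 := by
    rcases hdeg hr₁ f₁ with e | e
    · rw [e]; simp
    · omega
  have g₀ : p₀.natDegree ≤ 1 := by
    rcases hdeg hr₀ f₀ with e | e
    · rw [e]; simp
    · omega
  rw [Polynomial.eq_C_of_natDegree_eq_zero g₁, Polynomial.eq_X_add_C_of_natDegree_le_one g₀, g₂,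
    g₃] at hp
  exact ⟨p₀.coeff 1, p₁.coeff 0, p₀.coeff 0, by rw [hp]; simp; ring⟩

theorem linear_smul_mem_regularDifferentials [IsAlgClosed k] (h2 : (2 : k) ≠ 0)
    (hns : IsNonsingular A B C a b c) (hf : IsFunctionField (standardForm A B C a b c) x y)
    {ω : Ω[L⁄k]} (h : IsSmoothChart (dehomogenize (standardForm A B C a b c)) x y ω) :
    ω ∈ regularDifferentials k L ∧ x • ω ∈ regularDifferentials k L ∧
      y • ω ∈ regularDifferentials k L := by
  have hB := hns.snd_ne_zero
  have hx := hf.fst_ne_zero hB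
  have h' := h.inv h2 hns hx
  have hrel' := h'.relation
  rw [aeval_dehomogenize_standardForm] at hrel'
  have key : ∀ O : ValuationSubring L, (∀ c : k, κ c ∈ O) →
      ω ∈ Submodule.span O.toSubring (KaehlerDifferential.D k L '' (O : Set L)) ∧
      x • ω ∈ Submodule.span O.toSubring (KaehlerDifferential.D k L '' (O : Set L)) ∧
      y • ω ∈ Submodule.span O.toSubring (KaehlerDifferential.D k L '' (O : Set L)) := by
    intro O hO
    -- Every valuation ring contains the coordinates of one of the two charts, whose generators are
    -- `ω` and `-xω`.
    rcases O.mem_or_inv_mem x with hxO | hxO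
    · have hyO := snd_mem_of_fst_mem hB hf.equation O hO hxO
      have hω := h.mem_span O hO hxO hyO
      exact ⟨hω, Submodule.smul_mem _ (⟨x, hxO⟩ : O.toSubring) hω,
        Submodule.smul_mem _ (⟨y, hyO⟩ : O.toSubring) hω⟩
    · have hyO := snd_mem_of_fst_mem hB hrel' O hO hxO
      have hω := neg_mem (h'.mem_span O hO hxO hyO)
      rw [neg_neg] at hω
      refine ⟨?_, hω, ?_⟩
      · have := Submodule.smul_mem _ (⟨x⁻¹, hxO⟩ : O.toSubring) hω
        change x⁻¹ • x • ω ∈ _ at this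
        rwa [smul_smul, inv_mul_cancel₀ hx, one_smul] at this
      · have := Submodule.smul_mem _ (⟨y / x, hyO⟩ : O.toSubring) hω
        change (y / x) • x • ω ∈ _ at this
        rwa [smul_smul, div_mul_cancel₀ _ hx] at this
  exact ⟨fun O hO => (key O hO).1, fun O hO => (key O hO).2.1, fun O hO => (key O hO).2.2⟩

end RegularDifferentials

/-! ### Involutions of the quartic are linear -/

section LinearInvolutions

variable {k L : Type*} [Field k] [Field L] [Algebra k L] {A B C a b c : k} {x y : L}

local notation "κ" => algebraMap k L

/-- An involution of a smooth standard quartic is linear. -/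
theorem exists_matrix_of_involution [IsAlgClosed k] (h2 : (2 : k) ≠ 0)
    (hns : IsNonsingular A B C a b c) (hf : IsFunctionField (standardForm A B C a b c) x y)
    (σ : L ≃ₐ[k] L) (hσ : ∀ z, σ (σ z) = z) :
    ∃ (M : Matrix (Fin 3) (Fin 3) k) (l : L), l ≠ 0 ∧ M * M = 1 ∧
      ∀ i, l * σ (![x, y, 1] i) = ∑ j, κ (M i j) * ![x, y, 1] j := by
  have hB := hns.snd_ne_zero
  obtain ⟨ω, h⟩ := exists_isSmoothChart hf.generates ((hf.relations _).mpr dvd_rfl)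
    (hns.dehomogenize_smooth h2)
  have hω := h.ne_zero (hf.transcendental hB)
  obtain ⟨φ, hφ, hφD⟩ := exists_semilinear_map σ
  obtain ⟨l, hl⟩ := h.exists_smul_eq (φ ω)
  have hid : φ (φ ω) = ω := eq_id_of_semilinear (φ.comp φ) (fun z η => by simp [hφ, hσ])
    (fun z => by simp [hφD, hσ]) ω
  -- `σ` multiplies `ω` by `l`, and applying it twice is the identity.
  have hll : l * σ l = 1 := by
    rw [hl, hφ, hl, smul_smul] at hid
    have : (l * σ l - 1) • ω = 0 := by rw [sub_smul, mul_comm, hid, one_smul, sub_self]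
    exact sub_eq_zero.mp ((smul_eq_zero.mp this).resolve_right hω)
  obtain ⟨r1, rx, ry⟩ := linear_smul_mem_regularDifferentials h2 hns hf h
  have hrow : ∀ i, ∃ m : Fin 3 → k, l * σ (![x, y, 1] i) = ∑ j, κ (m j) * ![x, y, 1] j := by
    intro i
    have hi : (![x, y, 1] i) • ω ∈ regularDifferentials k L := by
      fin_cases i
      · exact rx
      · exact ry
      · simpa using r1
    have hi' := map_mem_regularDifferentials σ φ hφ hφD hi
    -- `σ` carries `gω` to `σ(g) l ω`, which is regular, so `l σ(g)` is linear for `g` among `x, y,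
    -- 1`.
    rw [hφ, hl, smul_smul] at hi'
    obtain ⟨α, β, γ, e⟩ := exists_linear_of_smul_mem_regularDifferentials h2 hns hf h hi'
    exact ⟨![α, β, γ], by rw [mul_comm, e]; simp [Fin.sum_univ_three]⟩
  obtain ⟨M, hM⟩ : ∃ M : Matrix (Fin 3) (Fin 3) k, ∀ i,
      l * σ (![x, y, 1] i) = ∑ j, κ (M i j) * ![x, y, 1] j := by
    choose M hM using hrow
    exact ⟨M, hM⟩
  refine ⟨M, l, left_ne_zero_of_mul_eq_one hll, ?_, hM⟩
  have hindep : ∀ m m' : Fin 3 → k, ∑ j, κ (m j) * ![x, y, 1] j = ∑ j, κ (m' j) * ![x, y, 1] j →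
      m = m' := by
    intro m m' e
    simp only [Fin.sum_univ_three] at e
    obtain ⟨e0, e1, e2⟩ := hf.linear_independent hB (α := m 0 - m' 0) (β := m 1 - m' 1)
      (γ := m 2 - m' 2) (by simp at e ⊢; linear_combination e)
    ext i
    fin_cases i
    · exact sub_eq_zero.mp e0
    · exact sub_eq_zero.mp e1
    · exact sub_eq_zero.mp e2
  suffices hsuff : ∀ i, (M * M : Matrix (Fin 3) (Fin 3) k) i = (1 : Matrix (Fin 3) (Fin 3) k) i from
    funext hsuff
  intro i
  apply hindep
  have e1 : ∑ j, κ ((1 : Matrix (Fin 3) (Fin 3) k) i j) * ![x, y, 1] j = ![x, y, 1] i := by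
    simp [Matrix.one_apply]
  rw [e1]
  have e2 := congrArg (fun z => l * σ z) (hM i)
  simp only [map_mul, hσ, map_sum, AlgEquiv.commutes] at e2
  rw [← mul_assoc, hll, one_mul] at e2
  rw [e2, Finset.mul_sum]
  simp only [mul_left_comm l, hM, Matrix.mul_apply, map_sum, map_mul, Finset.sum_mul,
    Finset.mul_sum]
  rw [Finset.sum_comm]
  simp only [mul_assoc]

/-- The form at `M(s, t, 1)` is expanded in powers of `t` with the same coefficients in `k[s]` over
both `L` and `k`, so that an identity found at the generic point of the curve can be read back over
`k`. -/
theorem exists_expansion (A B C a b c : k) (M : Matrix (Fin 3) (Fin 3) k) :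
    ∃ c₀ c₁ c₂ c₃ : Polynomial k,
      (∀ s t : L, standardValue (κ A) (κ B) (κ C) (κ a) (κ b) (κ c)
          (fun i => κ (M i 0) * s + κ (M i 1) * t + κ (M i 2)) =
        κ (standardValue A B C a b c fun i => M i 1) * t ^ 4 + Polynomial.aeval s c₃ * t ^ 3 +
          Polynomial.aeval s c₂ * t ^ 2 + Polynomial.aeval s c₁ * t + Polynomial.aeval s c₀) ∧
      ∀ s t : k, standardValue A B C a b c (fun i => M i 0 * s + M i 1 * t + M i 2) =
        (standardValue A B C a b c fun i => M i 1) * t ^ 4 + Polynomial.eval s c₃ * t ^ 3 +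
          Polynomial.eval s c₂ * t ^ 2 + Polynomial.eval s c₁ * t + Polynomial.eval s c₀ := by
  obtain ⟨P, hP⟩ : ∃ P : Fin 3 → Polynomial k, P = fun i =>
    Polynomial.C (M i 0) * Polynomial.X + Polynomial.C (M i 2) := ⟨_, rfl⟩
  obtain ⟨n, hn⟩ : ∃ n : Fin 3 → Polynomial k, n = fun i => Polynomial.C (M i 1) := ⟨_, rfl⟩
  refine ⟨standardValue (Polynomial.C A) (Polynomial.C B)
    (Polynomial.C C) (Polynomial.C a) (Polynomial.C b) (Polynomial.C c) P,
    4 * Polynomial.C A * n 0 * P 0 ^ 3 + 4 * Polynomial.C B * n 1 * P 1 ^ 3 +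
    4 * Polynomial.C C * n 2 * P 2 ^ 3 +
    Polynomial.C a * (2 * P 1 ^ 2 * P 2 * n 2 + 2 * P 1 * n 1 * P 2 ^ 2) +
    Polynomial.C b * (2 * P 0 ^ 2 * P 2 * n 2 + 2 * P 0 * n 0 * P 2 ^ 2) +
    Polynomial.C c * (2 * P 0 ^ 2 * P 1 * n 1 + 2 * P 0 * n 0 * P 1 ^ 2),
    6 * Polynomial.C A * n 0 ^ 2 * P 0 ^ 2 + 6 * Polynomial.C B * n 1 ^ 2 * P 1 ^ 2 +
    6 * Polynomial.C C * n 2 ^ 2 * P 2 ^ 2 +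
    Polynomial.C a * (P 1 ^ 2 * n 2 ^ 2 + 4 * P 1 * n 1 * P 2 * n 2 + n 1 ^ 2 * P 2 ^ 2) +
    Polynomial.C b * (P 0 ^ 2 * n 2 ^ 2 + 4 * P 0 * n 0 * P 2 * n 2 + n 0 ^ 2 * P 2 ^ 2) +
    Polynomial.C c * (P 0 ^ 2 * n 1 ^ 2 + 4 * P 0 * n 0 * P 1 * n 1 + n 0 ^ 2 * P 1 ^ 2),
    4 * Polynomial.C A * n 0 ^ 3 * P 0 + 4 * Polynomial.C B * n 1 ^ 3 * P 1 +
    4 * Polynomial.C C * n 2 ^ 3 * P 2 +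
    Polynomial.C a * (2 * P 1 * n 1 * n 2 ^ 2 + 2 * n 1 ^ 2 * P 2 * n 2) +
    Polynomial.C b * (2 * P 0 * n 0 * n 2 ^ 2 + 2 * n 0 ^ 2 * P 2 * n 2) +
    Polynomial.C c * (2 * P 0 * n 0 * n 1 ^ 2 + 2 * n 0 ^ 2 * P 1 * n 1), fun s t => ?_,
    fun s t => ?_⟩
  · rw [hP, hn]
    simp only [standardValue, map_add, map_mul, map_pow, Polynomial.aeval_C, Polynomial.aeval_X,
      map_ofNat]
    ring
  · rw [hP, hn]
    simp only [standardValue, Polynomial.eval_add, Polynomial.eval_mul, Polynomial.eval_pow,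
      Polynomial.eval_C, Polynomial.eval_X, Polynomial.eval_ofNat]
    ring

/-- The quartic form vanishing on a standard quartic is unique up to a scalar. -/
theorem exists_scalar_of_vanish [Infinite k] (hB : B ≠ 0)
    (hf : IsFunctionField (standardForm A B C a b c) x y) (M : Matrix (Fin 3) (Fin 3) k)
    (hM : standardValue (κ A) (κ B) (κ C) (κ a) (κ b) (κ c)
      (fun i => ∑ j, κ (M i j) * ![x, y, 1] j) = 0) :
    ∃ d : k, ∀ v, standardValue A B C a b c (M.mulVec v) = d * standardValue A B C a b c v := by
  obtain ⟨c₀, c₁, c₂, c₃, hL, hk⟩ := exists_expansion (L := L) A B C a b c M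
  -- With `d` matching the `y⁴` coefficients, the transformed form minus `d` times the form has
  -- degree at most 3 in `y`. It vanishes at the generic point, so all its coefficients are zero.
  obtain ⟨d, hd⟩ : ∃ d, d * B = standardValue A B C a b c (fun i => M i 1) :=
    ⟨_ / B, div_mul_cancel₀ _ hB⟩
  rw [← hd] at hL hk
  have hxy := hL x y
  simp only [Fin.sum_univ_three, Matrix.cons_val_zero, Matrix.cons_val_one, Matrix.cons_val,
    mul_one] at hM
  rw [hM] at hxy
  obtain ⟨h0, h1, h2, h3⟩ := hf.eq_zero_of_combination hB
    (p₀ := c₀ - Polynomial.C d * (Polynomial.C A * Polynomial.X ^ 4 + Polynomial.C C +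
      Polynomial.C b * Polynomial.X ^ 2)) (p₁ := c₁)
    (p₂ := c₂ - Polynomial.C d * (Polynomial.C a + Polynomial.C c * Polynomial.X ^ 2))
    (p₃ := c₃) (by
      simp only [map_sub, map_add, map_mul, map_pow, Polynomial.aeval_C, Polynomial.aeval_X]
      rw [map_mul] at hxy
      linear_combination -hxy - κ d * hf.equation)
  have haff : ∀ s t : k, standardValue A B C a b c (M.mulVec ![s, t, 1]) =
      d * standardValue A B C a b c ![s, t, 1] := by
    intro s t
    have e : M.mulVec ![s, t, 1] = fun i => M i 0 * s + M i 1 * t + M i 2 := by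
      ext i; simp [Matrix.mulVec, dotProduct, Fin.sum_univ_three]
    rw [e, hk, sub_eq_zero.mp h0, h1, sub_eq_zero.mp h2, h3]
    simp [standardValue]
    ring
  have hhom : ∀ (v : Fin 3 → k) (s : k),
      standardValue A B C a b c (s • v) = s ^ 4 * standardValue A B C a b c v := by
    intro v s
    simp [standardValue]; ring
  have hne : ∀ s t r : k, r ≠ 0 → standardValue A B C a b c (M.mulVec ![s, t, r]) =
      d * standardValue A B C a b c ![s, t, r] := by
    intro s t r hr
    have e : ![s, t, r] = r • ![s / r, t / r, 1] := by
      simp [Matrix.smul_cons, mul_div_cancel₀, hr]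
    rw [e, Matrix.mulVec_smul, hhom, hhom, haff]
    ring
  refine ⟨d, fun v => ?_⟩
  -- The identity holds for nonzero last coordinate `r` by homogeneity. As a polynomial in `r` it
  -- then also holds at `r = 0`.
  obtain ⟨Q, hQ⟩ : ∃ Q : Polynomial k, ∀ r, Q.eval r =
      standardValue A B C a b c (M.mulVec ![v 0, v 1, r]) -
        d * standardValue A B C a b c ![v 0, v 1, r] := by
    refine ⟨standardValue (Polynomial.C A) (Polynomial.C B) (Polynomial.C C) (Polynomial.C a)
      (Polynomial.C b) (Polynomial.C c) (fun i => Polynomial.C (M i 0 * v 0 + M i 1 * v 1) +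
        Polynomial.C (M i 2) * Polynomial.X) - Polynomial.C d *
      standardValue (Polynomial.C A) (Polynomial.C B) (Polynomial.C C) (Polynomial.C a)
        (Polynomial.C b) (Polynomial.C c) ![Polynomial.C (v 0), Polynomial.C (v 1),
          Polynomial.X], fun r => ?_⟩
    simp [standardValue, Matrix.mulVec, dotProduct, Fin.sum_univ_three]
  have hQ0 : Polynomial.X * Q = 0 := Polynomial.funext fun r => by
    rw [Polynomial.eval_mul, Polynomial.eval_X, Polynomial.eval_zero, hQ]
    by_cases hr : r = 0
    · simp [hr]
    · rw [hne _ _ _ hr, sub_self, mul_zero]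
  have hQ' : Q = 0 := (mul_eq_zero.mp hQ0).resolve_left Polynomial.X_ne_zero
  have hv := hQ (v 2)
  rw [hQ', Polynomial.eval_zero, show ![v 0, v 1, v 2] = v by ext i; fin_cases i <;> rfl] at hv
  exact (sub_eq_zero.mp hv.symm)

/-- An involution of a smooth standard quartic that is not one of the sign changes forces two of
`A a²`, `B b²`, `C c²` to agree. -/
theorem coeff_relation_of_automorphism [IsAlgClosed k] (h2 : (2 : k) ≠ 0)
    (hns : IsNonsingular A B C a b c) (hf : IsFunctionField (standardForm A B C a b c) x y)
    (σ : L ≃ₐ[k] L) (hσ : ∀ z, σ (σ z) = z)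
    (hxy : ¬ ((σ x = x ∨ σ x = -x) ∧ (σ y = y ∨ σ y = -y))) :
    A * a ^ 2 = B * b ^ 2 ∨ B * b ^ 2 = C * c ^ 2 ∨ C * c ^ 2 = A * a ^ 2 := by
  have hB := hns.snd_ne_zero
  have : Infinite k := IsAlgClosed.instInfinite
  obtain ⟨M, l, hl, hM, hMσ⟩ := exists_matrix_of_involution h2 hns hf σ hσ
  obtain ⟨d, hd⟩ := exists_scalar_of_vanish hB hf M (by
    have e := congrArg σ hf.equation
    simp only [map_add, map_mul, map_pow, AlgEquiv.commutes, map_zero] at e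
    simp only [← hMσ, standardValue]
    simp
    linear_combination l ^ 4 * e)
  refine coeff_relation_of_involution h2 hns.fst_ne_zero hB hns.trd_ne_zero (hns.sq_fst_ne h2)
    (hns.sq_snd_ne h2) (hns.sq_trd_ne h2) hns hM ?_ hd
  -- A diagonal involution has entries `±1`. The third row gives `l = ±1`, so `σ` would only change
  -- signs of `x` and `y`.
  by_contra! hdiag
  apply hxy
  have hsq : ∀ i, M i i = 1 ∨ M i i = -1 := by
    intro i
    have e := congrFun (congrFun hM i) i
    rw [Matrix.mul_apply, Finset.sum_eq_single i (fun j _ hj => by rw [hdiag i j hj.symm, zero_mul])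
      (by simp), Matrix.one_apply_eq] at e
    exact mul_self_eq_one_iff.mp e
  have hdia : ∀ i, l * σ (![x, y, 1] i) = κ (M i i) * ![x, y, 1] i := by
    intro i
    rw [hMσ i, Finset.sum_eq_single i (fun j _ hj => by rw [hdiag i j hj.symm, map_zero, zero_mul])
      (by simp)]
  have h0 := hdia 0
  have h1 := hdia 1
  have h3 := hdia 2
  simp at h0 h1 h3
  have key : ∀ {m m' : k} {z : L}, (m = 1 ∨ m = -1) → (m' = 1 ∨ m' = -1) → l = κ m' →
      l * σ z = κ m * z → σ z = z ∨ σ z = -z := by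
    intro m m' z hm hm' e e'
    rw [e] at e'
    rcases hm with rfl | rfl <;> rcases hm' with rfl | rfl <;>
      simp only [map_one, map_neg, one_mul, neg_mul] at e'
    · left; linear_combination e'
    · right; linear_combination -e'
    · right; linear_combination e'
    · left; linear_combination -e'
  exact ⟨key (hsq 0) (hsq 2) h3 h0, key (hsq 1) (hsq 2) h3 h1⟩

end LinearInvolutions

/-! ### Automorphisms and linear coordinate changes -/

section FunctionFields

open MvPolynomial

variable {k L : Type*} [Field k] [Field L] [Algebra k L]

theorem algEquiv_ext_of_adjoin {x y : L} (h : IntermediateField.adjoin k {x, y} = ⊤)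
    {σ τ : L ≃ₐ[k] L} (hx : σ x = τ x) (hy : σ y = τ y) : σ = τ := by
  ext z
  have hz : z ∈ IntermediateField.adjoin k {x, y} := by rw [h]; trivial
  induction hz using IntermediateField.adjoin_induction with
  | mem z hz => rcases hz with rfl | rfl <;> assumption
  | algebraMap c => simp
  | add a b _ _ ha hb => simp [ha, hb]
  | inv a _ ha => simp [ha]
  | mul a b _ _ ha hb => simp [ha, hb]

/-- Two systems of generators satisfying the same relations are related by an automorphism. -/
theorem IsFunctionField.exists_algEquiv {F : MvPolynomial (Fin 3) k} {x y x' y' : L}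
    (h : IsFunctionField F x y) (h' : IsFunctionField F x' y') :
    ∃ σ : L ≃ₐ[k] L, σ x = x' ∧ σ y = y' := by
  let R := Algebra.adjoin k {x, y}
  have hfrac : IsFractionRing R L := IsSmoothChart.isFractionRing_adjoin h.generates
  let θ : MvPolynomial (Fin 2) k →ₐ[k] R :=
    (aeval ![x, y]).codRestrict R (IsSmoothChart.aeval_mem_adjoin x y)
  have hθ : Function.Surjective θ := by
    rintro ⟨z, hz⟩
    obtain ⟨g, hg⟩ := (IsSmoothChart.mem_adjoin_iff x y z).mp hz
    exact ⟨g, Subtype.ext hg⟩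
  have hθ0 : ∀ g, θ g = 0 ↔ aeval ![x', y'] g = 0 := by
    intro g
    rw [h'.relations, ← h.relations]
    exact Subtype.ext_iff
  let e := Ideal.quotientKerAlgEquivOfSurjective hθ
  let q : (MvPolynomial (Fin 2) k ⧸ RingHom.ker θ) →ₐ[k] L :=
    Ideal.Quotient.liftₐ (RingHom.ker θ) (aeval ![x', y']) fun a ha => (hθ0 a).mp ha
  let g₀ : R →ₐ[k] L := q.comp e.symm.toAlgHom
  have hg₀ : ∀ g, g₀ (θ g) = aeval ![x', y'] g := by
    intro g
    have : e.symm (θ g) = Ideal.Quotient.mk (RingHom.ker θ) g := by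
      rw [AlgEquiv.symm_apply_eq]; rfl
    change q (e.symm (θ g)) = _
    rw [this]
    rfl
  have hinj : Function.Injective g₀ := by
    rw [injective_iff_map_eq_zero]
    intro z hz
    obtain ⟨g, rfl⟩ := hθ z
    rw [hg₀] at hz
    exact (hθ0 g).mpr hz
  let σ : L →ₐ[k] L := IsFractionRing.liftAlgHom (R := k) (A := R) (K := L) (L := L) (g := g₀) hinj
  have hσ : ∀ g : MvPolynomial (Fin 2) k, σ (aeval ![x, y] g) = aeval ![x', y'] g := by
    intro g
    rw [← hg₀ g]
    exact IsFractionRing.lift_algebraMap (A := R) (K := L) (L := L) (g := g₀.toRingHom) hinj (θ g)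
  have hσx : σ x = x' := by have := hσ (X 0); rwa [aeval_X, aeval_X] at this
  have hσy : σ y = y' := by have := hσ (X 1); rwa [aeval_X, aeval_X] at this
  have hsurj : Function.Surjective σ := by
    rw [← AlgHom.fieldRange_eq_top, eq_top_iff, ← h'.generates, IntermediateField.adjoin_le_iff]
    rintro z (rfl | rfl)
    · exact ⟨x, hσx⟩
    · exact ⟨y, hσy⟩
  exact ⟨AlgEquiv.ofBijective σ ⟨σ.injective, hsurj⟩, hσx, hσy⟩

/-- A linear change of the affine coordinates. -/
theorem IsFunctionField.linear {F F' : MvPolynomial (Fin 3) k} {x y : L}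
    (h : IsFunctionField F x y) {p q r s d : k} (hdet : p * s - q * r ≠ 0) (hd : d ≠ 0)
    (hF : aeval ![C p * X 0 + C q * X 1, C r * X 0 + C s * X 1] (dehomogenize F') =
      C d * dehomogenize F) :
    IsFunctionField F' (algebraMap k L p * x + algebraMap k L q * y)
      (algebraMap k L r * x + algebraMap k L s * y) := by
  let Θ : MvPolynomial (Fin 2) k →ₐ[k] MvPolynomial (Fin 2) k :=
    aeval ![C p * X 0 + C q * X 1, C r * X 0 + C s * X 1]
  let δ := (p * s - q * r)⁻¹
  have hδ : δ * (p * s - q * r) = 1 := inv_mul_cancel₀ hdet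
  -- Substitution by the inverse matrix.
  let Ξ : MvPolynomial (Fin 2) k →ₐ[k] MvPolynomial (Fin 2) k :=
    aeval ![C (δ * s) * X 0 + C (-δ * q) * X 1, C (-δ * r) * X 0 + C (δ * p) * X 1]
  have hC : (C δ : MvPolynomial (Fin 2) k) * (C p * C s - C q * C r) = 1 := by
    rw [← C_mul, ← C_mul, ← C_sub, ← C_mul, hδ, C_1]
  have h1 : Ξ.comp Θ = AlgHom.id k _ := by
    ext i : 1
    fin_cases i
    · simp [Θ, Ξ, algebraMap_eq]
      linear_combination X 0 * hC
    · simp [Θ, Ξ, algebraMap_eq]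
      linear_combination X 1 * hC
  have h2 : Θ.comp Ξ = AlgHom.id k _ := by
    ext i : 1
    fin_cases i
    · simp [Θ, Ξ, algebraMap_eq]
      linear_combination X 0 * hC
    · simp [Θ, Ξ, algebraMap_eq]
      linear_combination X 1 * hC
  let E := AlgEquiv.ofAlgHom Θ Ξ h2 h1
  have hδ' : algebraMap k L δ * (algebraMap k L p * algebraMap k L s -
      algebraMap k L q * algebraMap k L r) = 1 := by
    rw [← map_mul, ← map_mul, ← map_sub, ← map_mul, hδ, map_one]
  have hE : ∀ g, aeval ![algebraMap k L p * x + algebraMap k L q * y,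
      algebraMap k L r * x + algebraMap k L s * y] g = aeval ![x, y] (E g) := by
    intro g
    have : (aeval ![algebraMap k L p * x + algebraMap k L q * y,
      algebraMap k L r * x + algebraMap k L s * y]) = (aeval ![x, y]).comp Θ := by
      ext i
      fin_cases i <;> simp [Θ]
    exact DFunLike.congr_fun this g
  refine ⟨?_, fun g => ?_⟩
  · rw [eq_top_iff, ← h.generates, IntermediateField.adjoin_le_iff]
    set u := algebraMap k L p * x + algebraMap k L q * y with hu
    set v := algebraMap k L r * x + algebraMap k L s * y with hv
    have hu' : u ∈ IntermediateField.adjoin k {u, v} :=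
      IntermediateField.subset_adjoin _ _ (by simp)
    have hv' : v ∈ IntermediateField.adjoin k {u, v} :=
      IntermediateField.subset_adjoin _ _ (by simp)
    have hc : ∀ c : k, algebraMap k L c ∈ IntermediateField.adjoin k {u, v} :=
      fun c => IntermediateField.algebraMap_mem _ c
    rintro z (rfl | rfl)
    · have : z = algebraMap k L δ * (algebraMap k L s * u - algebraMap k L q * v) := by
        rw [hu, hv]; linear_combination -z * hδ'
      rw [SetLike.mem_coe, this]
      exact mul_mem (hc _) (sub_mem (mul_mem (hc _) hu') (mul_mem (hc _) hv'))
    · have : z = algebraMap k L δ * (algebraMap k L p * v - algebraMap k L r * u) := by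
        rw [hu, hv]; linear_combination -z * hδ'
      rw [SetLike.mem_coe, this]
      exact mul_mem (hc _) (sub_mem (mul_mem (hc _) hv') (mul_mem (hc _) hu'))
  · rw [hE, h.relations, ← map_dvd_iff E (a := dehomogenize F')]
    have : E (dehomogenize F') = C d * dehomogenize F := hF
    rw [this]
    have hu : IsUnit (C d : MvPolynomial (Fin 2) k) := (isUnit_iff_ne_zero.mpr hd).map C
    exact (hu.mul_left_dvd).symm

end FunctionFields

/-! ### Rotating the projective coordinates -/

section ChartChange

open MvPolynomial

variable {k : Type*} [Field k]

/-- Denominators are cleared by the same `N` and `h` in two fields at once: one evaluation uses the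
relations in `L`, the other takes place at the generic point of the plane. -/
theorem exists_chart_transform {L E : Type*} [Field L] [Algebra k L] [Field E] [Algebra k E]
    {x ξ : L} {y η : E} (hx : x ≠ 0) (hy : y ≠ 0) (g : MvPolynomial (Fin 2) k) :
    ∃ (N : ℕ) (h : MvPolynomial (Fin 2) k),
      aeval ![x, ξ] h = x ^ N * aeval ![ξ / x, x⁻¹] g ∧
      aeval ![y, η] h = y ^ N * aeval ![η / y, y⁻¹] g := by
  induction g using MvPolynomial.induction_on with
  | C c => exact ⟨0, C c, by simp, by simp⟩
  | add g₁ g₂ h₁ h₂ =>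
    obtain ⟨N₁, f₁, e₁, e₁'⟩ := h₁
    obtain ⟨N₂, f₂, e₂, e₂'⟩ := h₂
    refine ⟨N₁ + N₂, X 0 ^ N₂ * f₁ + X 0 ^ N₁ * f₂, ?_, ?_⟩
    · simp [e₁, e₂]; ring
    · simp [e₁', e₂']; ring
  | mul_X g i h =>
    obtain ⟨N, f, e, e'⟩ := h
    fin_cases i
    · refine ⟨N + 1, f * X 1, ?_, ?_⟩
      · simp [e]; field_simp; ring
      · simp [e']; field_simp; ring
    · refine ⟨N + 1, f, ?_, ?_⟩
      · simp [e]; field_simp; ring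
      · simp [e']; field_simp; ring

theorem exists_inverse_chart_transform {E : Type*} [Field E] [Algebra k E] {x y : E}
    (hy : y ≠ 0) (g : MvPolynomial (Fin 2) k) :
    ∃ (N : ℕ) (h : MvPolynomial (Fin 2) k), aeval ![x, y] h = y ^ N * aeval ![y⁻¹, x / y] g := by
  induction g using MvPolynomial.induction_on with
  | C c => exact ⟨0, C c, by simp⟩
  | add g₁ g₂ h₁ h₂ =>
    obtain ⟨N₁, f₁, e₁⟩ := h₁
    obtain ⟨N₂, f₂, e₂⟩ := h₂
    exact ⟨N₁ + N₂, X 1 ^ N₂ * f₁ + X 1 ^ N₁ * f₂, by simp [e₁, e₂]; ring⟩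
  | mul_X g i h =>
    obtain ⟨N, f, e⟩ := h
    fin_cases i
    · exact ⟨N + 1, f, by simp [e]; field_simp; ring⟩
    · exact ⟨N + 1, f * X 0, by simp [e]; field_simp; ring⟩

variable {L : Type*} [Field L] [Algebra k L]

theorem aeval_dehomogenize_rotate {A B C a b c : k} {x y : L} (hy : y ≠ 0) :
    aeval ![x, y] (dehomogenize (standardForm B C A b c a)) =
      y ^ 4 * aeval ![y⁻¹, x / y] (dehomogenize (standardForm A B C a b c)) := by
  rw [aeval_dehomogenize_standardForm, aeval_dehomogenize_standardForm]
  field_simp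
  ring

/-- A cyclic permutation of the homogeneous coordinates of a standard quartic. -/
theorem IsFunctionField.rotate {A B C a b c : k} {x y : L} (hx : x ≠ 0) (hA : A ≠ 0)
    (h : IsFunctionField (standardForm A B C a b c) x y) :
    IsFunctionField (standardForm B C A b c a) (y / x) x⁻¹ := by
  refine ⟨by rw [Set.pair_comm]; exact adjoin_inv_div_eq_top hx h.generates, fun g => ?_⟩
  have heq : aeval ![y / x, x⁻¹] (dehomogenize (standardForm B C A b c a)) = 0 := by
    rw [aeval_dehomogenize_standardForm]
    have := h.equation
    field_simp
    linear_combination this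
  constructor
  swap
  · rintro ⟨q, rfl⟩
    rw [map_mul, heq, zero_mul]
  intro hg
  let E := FractionRing (MvPolynomial (Fin 2) k)
  let ι := algebraMap (MvPolynomial (Fin 2) k) E
  have hι : Function.Injective ι := IsFractionRing.injective _ _
  have hιa : ∀ g, aeval ![ι (X 0), ι (X 1)] g = ι g := by
    intro g
    have : aeval ![ι (X 0), ι (X 1)] = IsScalarTower.toAlgHom k (MvPolynomial (Fin 2) k) E := by
      ext i; fin_cases i <;> simp [ι]
    exact DFunLike.congr_fun this g
  have hY : ι (X 1) ≠ 0 := (map_ne_zero_iff ι hι).mpr (X_ne_zero 1)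
  obtain ⟨N, f, hf, hf'⟩ := exists_chart_transform (ξ := y) (y := (ι (X 1))⁻¹)
    (η := ι (X 0) / ι (X 1)) hx (inv_ne_zero hY) g
  rw [hg, mul_zero, h.relations] at hf
  obtain ⟨e, he⟩ := hf
  obtain ⟨M, e', he'⟩ := exists_inverse_chart_transform (x := ι (X 0)) hY e
  rw [div_inv_eq_mul, div_mul_cancel₀ _ hY, inv_inv, hιa, he, map_mul,
    aeval_dehomogenize_standardForm] at hf'
  rw [hιa] at he'
  have hιf : ι (dehomogenize (standardForm B C A b c a)) =
      ι (X 1) ^ 4 * (algebraMap k E A * (ι (X 1))⁻¹ ^ 4 + algebraMap k E B *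
        (ι (X 0) / ι (X 1)) ^ 4 + algebraMap k E C + algebraMap k E a *
        (ι (X 0) / ι (X 1)) ^ 2 + algebraMap k E b * (ι (X 1))⁻¹ ^ 2 + algebraMap k E c *
        (ι (X 1))⁻¹ ^ 2 * (ι (X 0) / ι (X 1)) ^ 2) := by
    rw [← hιa, aeval_dehomogenize_rotate hY, aeval_dehomogenize_standardForm]
  -- Here `f = x^N g(y/x, 1/x)` vanishes on the old curve, so `f` is the old equation times `e`.
  -- Substituting `(1/Y, X/Y)` for the coordinates and clearing denominators turns this into a
  -- divisibility by the new equation, up to powers of `Y = X 1`.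
  have hkey : dehomogenize (standardForm B C A b c a) * (X 1 ^ N * e') = X 1 ^ (M + 4) * g := by
    apply hι
    rw [map_mul, map_mul, map_mul, hιf, he', map_pow, map_pow]
    have : ι (X 1) ^ N * (ι (X 1))⁻¹ ^ N = 1 := by
      rw [← mul_pow, mul_inv_cancel₀ hY, one_pow]
    linear_combination (ι (X 1) ^ (M + 4) * ι (X 1) ^ N) * hf' + (ι (X 1) ^ (M + 4) * ι g) * this
  have hprime : Prime (X 1 : MvPolynomial (Fin 2) k) := X_prime
  -- The constant term of the new equation is `A ≠ 0`, so the power of `X 1` can be cancelled.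
  have hnd : ¬ (X 1 : MvPolynomial (Fin 2) k) ∣ dehomogenize (standardForm B C A b c a) := by
    rintro ⟨q, hq⟩
    have e1 := congrArg (eval ![0, 0]) hq
    rw [map_mul, dehomogenize_standardForm] at e1
    simp at e1
    exact hA e1
  have hdvd : X 1 ^ (M + 4) ∣ X 1 ^ N * e' :=
    hprime.pow_dvd_of_dvd_mul_left _ hnd ⟨g, hkey⟩
  obtain ⟨q, hq⟩ := hdvd
  refine ⟨q, ?_⟩
  apply mul_left_cancel₀ (pow_ne_zero (M + 4) (X_ne_zero (R := k) (1 : Fin 2)))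
  rw [← hkey, hq]
  ring

end ChartChange

/-! ### The Klein four-group of sign changes -/

section SignGroup

variable {k L : Type*} [Field k] [Field L] [Algebra k L]

/-- The automorphisms changing at most the signs of `x` and `y`. -/
def signGroup (k : Type*) {L : Type*} [Field k] [Field L] [Algebra k L] (x y : L) :
    Subgroup (L ≃ₐ[k] L) where
  carrier := {σ | (σ x = x ∨ σ x = -x) ∧ (σ y = y ∨ σ y = -y)}
  one_mem' := ⟨Or.inl rfl, Or.inl rfl⟩
  mul_mem' := by
    rintro σ τ ⟨hσx, hσy⟩ ⟨hτx, hτy⟩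
    refine ⟨?_, ?_⟩
    · rcases hσx with h | h <;> rcases hτx with h' | h' <;> simp [h, h']
    · rcases hσy with h | h <;> rcases hτy with h' | h' <;> simp [h, h']
  inv_mem' := by
    rintro σ ⟨hx, hy⟩
    have key : ∀ z, σ z = z ∨ σ z = -z → σ⁻¹ z = z ∨ σ⁻¹ z = -z := by
      rintro z (h | h)
      · exact Or.inl (σ.injective (by rw [h]; exact σ.apply_symm_apply z))
      · exact Or.inr (σ.injective (by rw [map_neg, h, neg_neg]; exact σ.apply_symm_apply z))
    exact ⟨key x hx, key y hy⟩

variable {A B C a b c : k} {x y : L}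

theorem IsFunctionField.exists_sign (h : IsFunctionField (standardForm A B C a b c) x y)
    {p s : k} (hp : p ^ 2 = 1) (hs : s ^ 2 = 1) :
    ∃ σ : L ≃ₐ[k] L, σ x = algebraMap k L p * x ∧ σ y = algebraMap k L s * y := by
  have hp0 : p ≠ 0 := by rintro rfl; simp at hp
  have hs0 : s ≠ 0 := by rintro rfl; simp at hs
  have h' := h.linear (p := p) (q := 0) (r := 0) (s := s) (d := 1)
    (F' := standardForm A B C a b c) (by simp [hp0, hs0]) one_ne_zero (by
      have e1 : (MvPolynomial.C p : MvPolynomial (Fin 2) k) ^ 2 = 1 := by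
        rw [← map_pow, hp, map_one]
      have e2 : (MvPolynomial.C s : MvPolynomial (Fin 2) k) ^ 2 = 1 := by
        rw [← map_pow, hs, map_one]
      have e3 : (MvPolynomial.C p : MvPolynomial (Fin 2) k) ^ 4 = 1 := by
        rw [show 4 = 2 * 2 by rfl, pow_mul, e1, one_pow]
      have e4 : (MvPolynomial.C s : MvPolynomial (Fin 2) k) ^ 4 = 1 := by
        rw [show 4 = 2 * 2 by rfl, pow_mul, e2, one_pow]
      rw [dehomogenize_standardForm]
      simp [MvPolynomial.algebraMap_eq, mul_pow, e1, e2, e3, e4])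
  obtain ⟨σ, hx, hy⟩ := h.exists_algEquiv h'
  exact ⟨σ, by simpa using hx, by simpa using hy⟩

theorem IsFunctionField.isKleinFour_signGroup (h2 : (2 : k) ≠ 0)
    (h : IsFunctionField (standardForm A B C a b c) x y) (hx : x ≠ 0) (hy : y ≠ 0) :
    IsKleinFour (signGroup k x y) := by
  have h2L : (2 : L) ≠ 0 := by
    have := (map_ne_zero (algebraMap k L)).mpr h2
    rwa [map_ofNat] at this
  have hneg : ∀ z : L, z ≠ 0 → z ≠ -z := fun z hz e => by
    have : 2 * z = 0 := by linear_combination e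
    exact (mul_ne_zero h2L hz) this
  have hcard : Nat.card (signGroup k x y) = 4 := by
    let φ : signGroup k x y → L × L := fun σ => ((σ : L ≃ₐ[k] L) x, (σ : L ≃ₐ[k] L) y)
    have hφ : Function.Injective φ := fun σ τ e =>
      Subtype.ext (algEquiv_ext_of_adjoin h.generates (congrArg Prod.fst e) (congrArg Prod.snd e))
    have hrange : Set.range φ = {x, -x} ×ˢ {y, -y} := by
      ext ⟨z, w⟩
      constructor
      · rintro ⟨⟨σ, h1, h2⟩, e⟩
        obtain ⟨rfl, rfl⟩ := Prod.ext_iff.mp e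
        exact ⟨h1, h2⟩
      · rintro ⟨h1, h2⟩
        have key : ∀ u v : L, v ∈ ({u, -u} : Set L) → ∃ p : k, p ^ 2 = 1 ∧
            v = algebraMap k L p * u := by
          rintro u v (rfl | rfl)
          · exact ⟨1, by simp, by simp⟩
          · exact ⟨-1, by simp, by simp⟩
        obtain ⟨p, hp, e1⟩ := key x z h1
        obtain ⟨s, hs, e2⟩ := key y w h2
        obtain ⟨σ, e3, e4⟩ := h.exists_sign hp hs
        refine ⟨⟨σ, ?_, ?_⟩, ?_⟩
        · rw [e3, ← e1]; exact h1
        · rw [e4, ← e2]; exact h2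
        · simp only [φ]
          rw [e3, e4, ← e1, ← e2]
    rw [← Nat.card_range_of_injective hφ, Nat.card_coe_set_eq, hrange, Set.ncard_prod,
      Set.ncard_pair (hneg x hx), Set.ncard_pair (hneg y hy)]
  refine ⟨hcard, ?_⟩
  have hdvd : Monoid.exponent (signGroup k x y) ∣ 2 := by
    apply Monoid.exponent_dvd_of_forall_pow_eq_one
    rintro ⟨σ, h1, h2⟩
    apply Subtype.ext
    apply algEquiv_ext_of_adjoin h.generates
    · rcases h1 with h1 | h1 <;> simp [pow_two, h1]
    · rcases h2 with h2 | h2 <;> simp [pow_two, h2]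
  rcases (Nat.dvd_prime Nat.prime_two).mp hdvd with h1 | h1
  · rw [Monoid.exp_eq_one_iff] at h1
    have := Nat.card_unique (α := signGroup k x y)
    omega
  · exact h1

end SignGroup

/-! ### The quotient by the sign changes is rational -/

section Quotient

open IntermediateField

/-- A field generated by two square roots has degree at most four. -/
theorem finrank_le_four_of_sq {K L : Type*} [Field K] [Field L] [Algebra K L] {x y : L} {X Y : K}
    (hx : x ^ 2 = algebraMap K L X) (hy : y ^ 2 = algebraMap K L Y)
    (h : (K⟮x⟯ ⊔ K⟮y⟯ : IntermediateField K L) = ⊤) :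
    FiniteDimensional K L ∧ Module.finrank K L ≤ 4 := by
  have key : ∀ (z : L) (Z : K), z ^ 2 = algebraMap K L Z →
      FiniteDimensional K K⟮z⟯ ∧ Module.finrank K K⟮z⟯ ≤ 2 := by
    intro z Z hz
    have hm : (Polynomial.X ^ 2 - Polynomial.C Z).Monic :=
      Polynomial.monic_X_pow_sub_C Z two_ne_zero
    have hr : Polynomial.aeval z (Polynomial.X ^ 2 - Polynomial.C Z) = 0 := by simp [hz]
    have hint : IsIntegral K z := ⟨_, hm, hr⟩
    refine ⟨adjoin.finiteDimensional hint, ?_⟩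
    rw [adjoin.finrank hint]
    refine (Polynomial.natDegree_le_natDegree (minpoly.min K z hm hr)).trans ?_
    rw [Polynomial.natDegree_X_pow_sub_C]
  obtain ⟨fx, dx⟩ := key x X hx
  obtain ⟨fy, dy⟩ := key y Y hy
  have hfin := IntermediateField.finiteDimensional_sup K⟮x⟯ K⟮y⟯
  have hle := IntermediateField.finrank_sup_le K⟮x⟯ K⟮y⟯
  rw [h] at hfin hle
  rw [IntermediateField.finrank_top'] at hle
  refine ⟨Module.Finite.equiv (IntermediateField.topEquiv (F := K) (E := L)).toLinearEquiv, ?_⟩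
  exact hle.trans (Nat.mul_le_mul dx dy)

variable {k L : Type*} [Field k] [Field L] [Algebra k L]

theorem transcendental_of_notMem_range [IsAlgClosed k] {t : L}
    (ht : ∀ τ : k, algebraMap k L τ ≠ t) : Transcendental k t := by
  intro halg
  have hint := halg.isIntegral
  obtain ⟨τ, hτ⟩ := minpoly.mem_range_of_degree_eq_one k t
    (IsAlgClosed.degree_eq_one_of_irreducible k (minpoly.irreducible hint))
  exact ht τ hτ

variable {A B C a b c : k} {x y : L}

/-- The quotient of a standard quartic by its group of sign changes is a rational curve: it is
the conic `A X² + B Y² + C Z² + a Y Z + b X Z + c X Y = 0`. -/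
theorem IsFunctionField.nonempty_algEquiv_fixedField_signGroup [IsAlgClosed k] (h2 : (2 : k) ≠ 0)
    (h : IsFunctionField (standardForm A B C a b c) x y) (hA : A ≠ 0) (hB : B ≠ 0)
    (hx : x ≠ 0) (hy : y ≠ 0) :
    Nonempty (RatFunc k ≃ₐ[k] fixedField (signGroup k x y)) := by
  -- `(X₀, 0)` is a point of the conic satisfied by `(x², y²)`. The slope `t = y² / (x² - X₀)` of
  -- the line through it parametrizes the conic, and `hSeq` gives the second intersection point.
  obtain ⟨X₀, hX₀⟩ := IsAlgClosed.exists_root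
    (Polynomial.C A * Polynomial.X ^ 2 + Polynomial.C b * Polynomial.X + Polynomial.C C)
    (by rw [Polynomial.degree_quadratic hA]; norm_num)
  have hX₀' : algebraMap k L A * algebraMap k L X₀ ^ 2 + algebraMap k L b * algebraMap k L X₀ +
      algebraMap k L C = 0 := by
    simpa using congrArg (algebraMap k L) hX₀
  have hS : x ^ 2 - algebraMap k L X₀ ≠ 0 := by
    intro e
    have := (h.eq_zero_of_combination hB (p₀ := Polynomial.X ^ 2 - Polynomial.C X₀) (p₁ := 0)
      (p₂ := 0) (p₃ := 0) (by simp [e])).1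
    exact (Polynomial.monic_X_pow_sub_C X₀ two_ne_zero).ne_zero this
  obtain ⟨S, hSdef⟩ : ∃ S, x ^ 2 - algebraMap k L X₀ = S := ⟨_, rfl⟩
  obtain ⟨t, htdef⟩ : ∃ t, y ^ 2 / S = t := ⟨_, rfl⟩
  rw [hSdef] at hS
  have hyt : y ^ 2 = t * S := by rw [← htdef, div_mul_cancel₀ _ hS]
  have hxS : x ^ 2 = S + algebraMap k L X₀ := by rw [← hSdef]; ring
  have htr : Transcendental k t := by
    apply transcendental_of_notMem_range
    intro τ hτ
    have := (h.eq_zero_of_combination hB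
      (p₀ := -(Polynomial.C τ * (Polynomial.X ^ 2 - Polynomial.C X₀))) (p₁ := 0)
      (p₂ := 1) (p₃ := 0) (by simp [hτ, hSdef, hyt])).2.2.1
    exact one_ne_zero this
  have hD : algebraMap k L A + algebraMap k L c * t + algebraMap k L B * t ^ 2 ≠ 0 := by
    intro e
    have h0 := transcendental_iff.mp htr (Polynomial.C B * Polynomial.X ^ 2 +
      Polynomial.C c * Polynomial.X + Polynomial.C A) (by simp; linear_combination e)
    rw [Polynomial.ext_iff] at h0
    exact hB (by simpa [Polynomial.coeff_X, Polynomial.coeff_C] using h0 2)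
  have hSeq : S = -(2 * algebraMap k L A * algebraMap k L X₀ + algebraMap k L b +
      algebraMap k L a * t + algebraMap k L c * algebraMap k L X₀ * t) /
      (algebraMap k L A + algebraMap k L c * t + algebraMap k L B * t ^ 2) := by
    rw [eq_div_iff hD]
    apply mul_left_cancel₀ hS
    have heq := h.equation
    rw [show x ^ 4 = (x ^ 2) ^ 2 by ring, show y ^ 4 = (y ^ 2) ^ 2 by ring, hyt, hxS] at heq
    linear_combination heq - hX₀'
  have htK : t ∈ k⟮t⟯ := mem_adjoin_simple_self k t
  have hc : ∀ c : k, algebraMap k L c ∈ k⟮t⟯ := fun c => IntermediateField.algebraMap_mem _ c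
  have hSK : S ∈ k⟮t⟯ := by
    rw [hSeq]
    refine div_mem (neg_mem (add_mem (add_mem (add_mem (mul_mem (mul_mem ?_ (hc A)) (hc X₀)) (hc b))
      (mul_mem (hc a) htK)) (mul_mem (mul_mem (hc c) (hc X₀)) htK)))
      (add_mem (add_mem (hc A) (mul_mem (hc c) htK)) (mul_mem (hc B) (pow_mem htK 2)))
    exact ofNat_mem _ 2
  have hxK : x ^ 2 ∈ k⟮t⟯ := by rw [hxS]; exact add_mem hSK (hc X₀)
  have hyK : y ^ 2 ∈ k⟮t⟯ := by rw [hyt]; exact mul_mem htK hSK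
  have htop : (k⟮t⟯⟮x⟯ ⊔ k⟮t⟯⟮y⟯ : IntermediateField k⟮t⟯ L) = ⊤ := by
    have hle : adjoin k {x, y} ≤ (k⟮t⟯⟮x⟯ ⊔ k⟮t⟯⟮y⟯ : IntermediateField k⟮t⟯ L).restrictScalars k := by
      rw [adjoin_le_iff]
      rintro z (rfl | rfl)
      · exact (le_sup_left : _ ≤ k⟮t⟯⟮z⟯ ⊔ k⟮t⟯⟮y⟯) (mem_adjoin_simple_self _ z)
      · exact (le_sup_right : _ ≤ k⟮t⟯⟮x⟯ ⊔ k⟮t⟯⟮z⟯) (mem_adjoin_simple_self _ z)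
    rw [h.generates] at hle
    exact eq_top_iff.mpr fun z _ => hle (mem_top : z ∈ (⊤ : IntermediateField k L))
  obtain ⟨hfin, hrank⟩ := finrank_le_four_of_sq (K := k⟮t⟯) (x := x) (y := y) (X := ⟨x ^ 2, hxK⟩)
    (Y := ⟨y ^ 2, hyK⟩) rfl rfl htop
  have hle : k⟮t⟯ ≤ fixedField (signGroup k x y) := by
    rw [adjoin_simple_le_iff, mem_fixedField_iff]
    rintro σ ⟨h1, h2⟩
    have e1 : σ x ^ 2 = x ^ 2 := by rcases h1 with h1 | h1 <;> rw [h1]; ring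
    have e2 : σ y ^ 2 = y ^ 2 := by rcases h2 with h2 | h2 <;> rw [h2]; ring
    rw [← htdef, ← hSdef, map_div₀, map_sub, map_pow, map_pow, e1, e2, AlgEquiv.commutes]
  have hklein := h.isKleinFour_signGroup h2 hx hy
  have hcard : Module.finrank (fixedField (signGroup k x y)) L = 4 := by
    have : Finite (signGroup k x y) := Nat.finite_of_card_ne_zero (by rw [hklein.card_four]; simp)
    have := Fintype.ofFinite (signGroup k x y)
    rw [← hklein.card_four, Nat.card_eq_fintype_card]
    exact FixedPoints.finrank_eq_card (signGroup k x y) L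
  -- `k(t)` lies in the fixed field, and `L` has degree at most 4 over the former and exactly 4 over
  -- the latter, so they coincide.
  have heq := eq_of_le_of_finrank_le' hle (by rw [hcard]; exact hrank)
  exact ⟨(RatFunc.algEquivOfTranscendental t htr).trans (equivOfEq heq)⟩

end Quotient

/-! ### A coefficient relation produces a second Ciani subgroup -/

section Special

variable {k L : Type*} [Field k] [Field L] [Algebra k L] {A B C a b c : k} {x y : L}

theorem IsFunctionField.snd_ne_zero (h : IsFunctionField (standardForm A B C a b c) x y)
    (hB : B ≠ 0) : y ≠ 0 := by
  rintro rfl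
  exact one_ne_zero (h.linear_independent hB (α := 0) (β := 1) (γ := 0) (by simp)).2.1

theorem IsFunctionField.isCianiSubgroup_signGroup [IsAlgClosed k] (h2 : (2 : k) ≠ 0)
    (hk : genus k (RatFunc k) = 0) (h : IsFunctionField (standardForm A B C a b c) x y)
    (hA : A ≠ 0) (hB : B ≠ 0) : IsCianiSubgroup k (signGroup k x y) := by
  have hx := h.fst_ne_zero hB
  have hy := h.snd_ne_zero hB
  obtain ⟨e⟩ := h.nonempty_algEquiv_fixedField_signGroup h2 hA hB hx hy
  exact ⟨h.isKleinFour_signGroup h2 hx hy, genus_eq_zero_of_algEquiv e hk⟩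

/-- After replacing `y` by `ry` the form becomes symmetric in its first two variables. When `a = b =
0` a fourth root of `B / A` serves; otherwise `r² = a / b`, and the relation forces `B = Ar⁴`. -/
theorem exists_scaling [IsAlgClosed k] (hA : A ≠ 0) (hB : B ≠ 0)
    (hrel : A * a ^ 2 = B * b ^ 2) : ∃ r : k, r ≠ 0 ∧ a = b * r ^ 2 ∧ B = A * r ^ 4 := by
  by_cases hb : b = 0
  · have ha : a = 0 := by simpa [hb, hA] using hrel
    obtain ⟨r, hr⟩ := IsAlgClosed.exists_pow_nat_eq (B / A) (n := 4) (by norm_num)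
    rw [eq_div_iff hA] at hr
    refine ⟨r, ?_, by simp [ha, hb], by rw [← hr, mul_comm]⟩
    rintro rfl
    exact hB (by rw [← hr]; simp)
  · have ha : a ≠ 0 := by
      rintro rfl
      have : B * b ^ 2 = 0 := by rw [← hrel]; ring
      exact mul_ne_zero hB (pow_ne_zero 2 hb) this
    obtain ⟨r, hr⟩ := IsAlgClosed.exists_pow_nat_eq (a / b) (n := 2) (by norm_num)
    rw [eq_div_iff hb] at hr
    refine ⟨r, ?_, by rw [← hr, mul_comm], ?_⟩
    · rintro rfl
      exact ha (by rw [← hr]; simp)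
    · apply mul_right_cancel₀ (pow_ne_zero 2 hb)
      rw [← hrel, ← hr]
      ring

/-- If `A a² = B b²`, exchanging `X` and `Y` up to scaling gives a further automorphism and another
system of coordinates in which the quartic is in standard form. -/
theorem IsFunctionField.isSpecial_of_relation [IsAlgClosed k] (h2 : (2 : k) ≠ 0)
    (hk : genus k (RatFunc k) = 0) (hns : IsNonsingular A B C a b c)
    (h : IsFunctionField (standardForm A B C a b c) x y) (hrel : A * a ^ 2 = B * b ^ 2) :
    IsSpecial k L := by
  have hA := hns.fst_ne_zero
  have hB := hns.snd_ne_zero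
  obtain ⟨r, hr, ha, hBr⟩ := exists_scaling hA hB hrel
  obtain ⟨d, hd⟩ : ∃ d, c = d * r ^ 2 := ⟨c / r ^ 2, by field_simp⟩
  -- `d = -2A` would give `c² = 4AB`.
  have hA' : 2 * A + d ≠ 0 := by
    intro e
    apply hns.sq_trd_ne h2
    rw [hd, hBr, eq_neg_of_add_eq_zero_right e]
    ring
  have h16 : (16 : k) ≠ 0 := by
    rw [show (16 : k) = 2 ^ 4 by norm_num]
    exact pow_ne_zero 4 h2
  -- With `u = x + ry` and `v = x - ry`, 16 times the symmetric form is again a standard form in `u,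
  -- v`.
  have h' := h.linear (p := 1) (q := r) (r := 1) (s := -r) (d := 16)
    (F' := standardForm (2 * A + d) (2 * A + d) (16 * C) (8 * b) (8 * b) (12 * A - 2 * d))
    (by
      rw [show 1 * -r - r * 1 = -(2 * r) by ring]
      exact neg_ne_zero.mpr (mul_ne_zero h2 hr)) h16 (by
      rw [dehomogenize_standardForm, dehomogenize_standardForm, ha, hBr, hd]
      have hC : ∀ n : ℕ, [n.AtLeastTwo] →
          MvPolynomial.C (OfNat.ofNat n : k) = (OfNat.ofNat n : MvPolynomial (Fin 2) k) :=
        fun n _ => map_ofNat MvPolynomial.C n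
      simp [MvPolynomial.algebraMap_eq]
      simp only [hC]
      ring)
  -- Fixing `u` and negating `v` exchanges `x` and `ry`, which is not a sign change of `x` and `y`.
  obtain ⟨σ, hσu, hσv⟩ := h'.exists_sign (p := 1) (s := -1) (by norm_num) (by norm_num)
  refine ⟨_, _, h.isCianiSubgroup_signGroup h2 hk hA hB, h'.isCianiSubgroup_signGroup h2 hk hA' hA',
    fun e => ?_⟩
  have hmem : σ ∈ signGroup k x y := by
    rw [e]
    exact ⟨Or.inl (by simpa using hσu), Or.inr (by simpa using hσv)⟩
  have hσx : σ x = algebraMap k L r * y := by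
    simp only [map_add, map_mul, map_neg, map_one, AlgEquiv.commutes] at hσu hσv
    have h2L : (2 : L) ≠ 0 := by
      have := (map_ne_zero (algebraMap k L)).mpr h2
      rwa [map_ofNat] at this
    apply mul_left_cancel₀ h2L
    linear_combination hσu + hσv
  rcases hmem.1 with h1 | h1
  · have := (h.linear_independent hB (α := -1) (β := r) (γ := 0) (by
      simp; linear_combination h1 - hσx)).2.1
    exact hr this
  · have := (h.linear_independent hB (α := 1) (β := r) (γ := 0) (by
      simp; linear_combination h1 - hσx)).2.1
    exact hr this

theorem IsFunctionField.isSpecial [IsAlgClosed k] (h2 : (2 : k) ≠ 0)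
    (hk : genus k (RatFunc k) = 0) (hns : IsNonsingular A B C a b c)
    (h : IsFunctionField (standardForm A B C a b c) x y)
    (hrel : A * a ^ 2 = B * b ^ 2 ∨ B * b ^ 2 = C * c ^ 2 ∨ C * c ^ 2 = A * a ^ 2) :
    IsSpecial k L := by
  have h' := h.rotate (h.fst_ne_zero hns.snd_ne_zero) hns.fst_ne_zero
  have h'' := h'.rotate (h'.fst_ne_zero hns.trd_ne_zero) hns.snd_ne_zero
  rcases hrel with hrel | hrel | hrel
  · exact h.isSpecial_of_relation h2 hk hns hrel
  · exact h'.isSpecial_of_relation h2 hk hns.rotate hrel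
  · exact h''.isSpecial_of_relation h2 hk hns.rotate.rotate hrel

end Special
end Ciani

/-! ### The theorem -/

theorem lemma3p4 {K k L : Type*} [Field K] [Field k] [Field L]
    [IsAlgClosed k] [Algebra K k] [Algebra k L] (h2 : (2 : K) ≠ 0)
    (I : Ciani.Invariants K)
    -- the smooth quartic `Y`, its function field `L`, and the Ciani subgroup `V`
    (Y : Ciani.SmoothQuartic k) (x y : L) (hL : Ciani.IsFunctionField Y.form x y)
    (V : Subgroup (L ≃ₐ[k] L)) (hV : Ciani.IsCianiSubgroup k V)
    (hI : Ciani.HasInvariants V (I.map (algebraMap K k))) :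
    (Ciani.IsSpecial k L ↔ I.Q = 0) ∧
      I.Q = -4 * I.I3 * I.I3' ^ 3 * I.I6 - 27 * I.I3 ^ 2 * I.I6 ^ 2
        + 18 * I.I3 * I.I3' * I.I6 * I.aux + I.I3' ^ 2 * I.aux ^ 2 - 4 * I.aux ^ 3 := by
  refine ⟨?_, Ciani.Invariants.Q_formula h2 I⟩
  have h2k : (2 : k) ≠ 0 := by
    have := (map_ne_zero (algebraMap K k)).mpr h2
    rwa [map_ofNat] at this
  obtain ⟨A, B, C, a, b, c, ⟨Y₁, u, v, hY₁, hf, hmem⟩, hsame⟩ := hI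
  have hns := Y₁.isNonsingular h2k hY₁
  rw [hY₁] at hf
  have hQ : I.Q = 0 ↔ A * a ^ 2 = B * b ^ 2 ∨ B * b ^ 2 = C * c ^ 2 ∨ C * c ^ 2 = A * a ^ 2 := by
    rw [← Ciani.standardInvariants_Q_eq_zero_iff h2k, ← hsame.Q_eq_zero_iff,
      Ciani.Invariants.Q_map, map_eq_zero]
  rw [hQ]
  constructor
  · rintro ⟨W₁, W₂, hW₁, hW₂, hne⟩
    obtain ⟨W, hW, hWV⟩ : ∃ W : Subgroup (L ≃ₐ[k] L), Ciani.IsCianiSubgroup k W ∧ W ≠ V := by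
      by_cases h : W₁ = V
      · exact ⟨W₂, hW₂, fun e => hne (h.trans e.symm)⟩
      · exact ⟨W₁, hW₁, h⟩
    -- Two distinct groups of order 4 cannot be contained in one another.
    obtain ⟨σ, hσW, hσV⟩ : ∃ σ ∈ W, σ ∉ V := by
      by_contra! hle
      have : Finite V := Nat.finite_of_card_ne_zero (by rw [hV.klein.card_four]; simp)
      exact hWV (Subgroup.eq_of_le_of_card_ge hle
        (by rw [hV.klein.card_four, hW.klein.card_four]))
    have hσ : σ * σ = 1 := by
      have := hW.klein
      exact congrArg Subtype.val (IsKleinFour.mul_self (⟨σ, hσW⟩ : W))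
    exact Ciani.coeff_relation_of_automorphism h2k hns hf σ
      (fun z => DFunLike.congr_fun hσ z) fun h => hσV ((hmem σ).mpr h)
  · have hVs : V = Ciani.signGroup k u v := Subgroup.ext hmem
    obtain ⟨e⟩ := hf.nonempty_algEquiv_fixedField_signGroup h2k hns.fst_ne_zero hns.snd_ne_zero
      (hf.fst_ne_zero hns.snd_ne_zero) (hf.snd_ne_zero hns.snd_ne_zero)
    -- The fixed field of `V` is isomorphic to `k(t)`, so the hypothesis on `V` supplies the genus
    -- of the projective line.
    have hk : Ciani.genus k (RatFunc k) = 0 := by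
      have hg := hV.genus_quotient
      rw [hVs] at hg
      exact Ciani.genus_eq_zero_of_algEquiv e.symm hg
    exact hf.isSpecial h2k hk hns
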